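/- Let $K$ be a field of characteristic zero and let $A_1 = A_1(K) = K\langle X, Y \mid YX - XY = 1\rangle$ be the first Weyl algebra over $K$. Endomorphisms, automorphisms, anti-endomorphisms and anti-automorphisms of $A_1$ are understood to be $K$-linear and unital, and an involution on $A_1$ is an anti-automorphism $\gamma$ with $\gamma\circ\gamma = \mathrm{id}$. Let $\alpha$ be the exchange involution of $A_1$, given by $\alpha(X) = Y$ and $\alpha(Y) = X$. An involution $\gamma$ is said to be conjugate to $\alpha$ if $\gamma = g^{-1}\alpha g$ for some automorphism or anti-automorphism $g$ of $A_1$. An $\alpha$-endomorphism (respectively, $\alpha$-anti-endomorphism) of $A_1$ is an endomorphism (respectively, anti-endomorphism) of $A_1$ that commutes with $\alpha$. Consider the following statements: (D) (Dixmier conjecture) Every endomorphism of $A_1$ is an automorphism. (GD) ($\gamma,\delta$ conjecture, first version) For every endomorphism $f$ of $A_1$ there exist involutions $\gamma$ and $\delta$ on $A_1$, each of them conjugate to $\alpha$, such that $f\circ\gamma = \delta\circ f$. (GH) ($g,h$ conjecture, first version) For every endomorphism $f$ of $A_1$ there exist $g$ and $h$, each an automorphism or an anti-automorphism of $A_1$,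 such that either $g$ and $h$ are both automorphisms or both anti-automorphisms and $h f g^{-1}$ is an $\alpha$-endomorphism, or one of $g$ and $h$ is an automorphism, the other is an anti-automorphism, and $h f g^{-1}$ is an $\alpha$-anti-endomorphism. Then (D) is equivalent to (GD), and (D) is equivalent to (GH). -/

import Mathlib

universe u

namespace DixmierA1

open MulOpposite

/-! ## The first Weyl algebra -/

/-- The defining relation `Y X = X Y + 1` on the free algebra on two generators,
where the generator `0` is `X` and the generator `1` is `Y`. -/
inductive WeylRel (K : Type u) [Field K] :
    FreeAlgebra K (Fin 2) → FreeAlgebra K (Fin 2) → Prop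
  | comm : WeylRel K (FreeAlgebra.ι K 1 * FreeAlgebra.ι K 0)
      (FreeAlgebra.ι K 0 * FreeAlgebra.ι K 1 + 1)

/-- The first Weyl algebra `A₁(K) = K⟨X, Y | YX - XY = 1⟩`. -/
abbrev A₁ (K : Type u) [Field K] : Type u := RingQuot (WeylRel K)

noncomputable section

variable (K : Type u) [Field K]

/-- The generator `X` of `A₁(K)`. -/
def X : A₁ K := RingQuot.mkAlgHom K (WeylRel K) (FreeAlgebra.ι K 0)

/-- The generator `Y` of `A₁(K)`. -/
def Y : A₁ K := RingQuot.mkAlgHom K (WeylRel K) (FreeAlgebra.ι K 1)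

theorem Y_mul_X : Y K * X K = X K * Y K + 1 := by
  have h := RingQuot.mkAlgHom_rel K (WeylRel.comm (K := K))
  simpa [X, Y] using h

/-- The algebra homomorphism out of `A₁(K)` determined by a pair `(p, q)` with `qp = pq + 1`. -/
def lift {B : Type u} [Ring B] [Algebra K B] (p q : B) (h : q * p = p * q + 1) :
    A₁ K →ₐ[K] B :=
  RingQuot.liftAlgHom K ⟨FreeAlgebra.lift K ![p, q], by
    rintro _ _ ⟨⟩
    simpa using h⟩

theorem lift_X {B : Type u} [Ring B] [Algebra K B] (p q : B) (h : q * p = p * q + 1) :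
    lift K p q h (X K) = p := by
  simp [lift, X]

theorem lift_Y {B : Type u} [Ring B] [Algebra K B] (p q : B) (h : q * p = p * q + 1) :
    lift K p q h (Y K) = q := by
  simp [lift, Y]

/-- The exchange map as an algebra homomorphism to the opposite algebra: `X ↦ Y`, `Y ↦ X`. -/
def exchangeOp : A₁ K →ₐ[K] (A₁ K)ᵐᵒᵖ :=
  lift K (op (Y K)) (op (X K)) (by
    rw [← op_mul, ← op_mul, Y_mul_X, op_add, op_one])

/-- The exchange involution `α` of `A₁(K)`: the anti-endomorphism with `α X = Y`, `α Y = X`. -/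
def α : A₁ K →ₗ[K] A₁ K :=
  (opLinearEquiv K).symm.toLinearMap ∘ₗ (exchangeOp K).toLinearMap

variable {K}

/-! ## Endomorphisms, anti-endomorphisms, involutions

All maps are regarded as `K`-linear maps, so that endomorphisms and anti-endomorphisms of the
algebra can be composed with one another. -/

/-- `φ` is an endomorphism of the (unital) `K`-algebra `A₁(K)`. -/
def IsEndo (φ : A₁ K →ₗ[K] A₁ K) : Prop :=
  ∃ f : A₁ K →ₐ[K] A₁ K, ∀ a, f a = φ a

/-- `φ` is an anti-endomorphism of the (unital) `K`-algebra `A₁(K)`,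
i.e. a homomorphism into the opposite algebra. -/
def IsAntiEndo (φ : A₁ K →ₗ[K] A₁ K) : Prop :=
  ∃ f : A₁ K →ₐ[K] (A₁ K)ᵐᵒᵖ, ∀ a, f a = op (φ a)

/-- `g` is an automorphism of `A₁(K)`. -/
def IsAuto (g : A₁ K ≃ₗ[K] A₁ K) : Prop := IsEndo g.toLinearMap

/-- `g` is an anti-automorphism of `A₁(K)`. -/
def IsAntiAuto (g : A₁ K ≃ₗ[K] A₁ K) : Prop := IsAntiEndo g.toLinearMap

/-- `γ` is an involution on `A₁(K)`: an anti-endomorphism with `γ ∘ γ = id`. -/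
def IsInvolution (γ : A₁ K →ₗ[K] A₁ K) : Prop :=
  IsAntiEndo γ ∧ γ ∘ₗ γ = LinearMap.id

/-- `γ` is conjugate to `α`: `γ = g⁻¹ ∘ α ∘ g` for some automorphism or anti-automorphism `g`. -/
def IsConjugateToExchange (γ : A₁ K →ₗ[K] A₁ K) : Prop :=
  ∃ g : A₁ K ≃ₗ[K] A₁ K, (IsAuto g ∨ IsAntiAuto g) ∧
    γ = g.symm.toLinearMap ∘ₗ α K ∘ₗ g.toLinearMap

/-- The endomorphism `f` is a `γ,δ`-endomorphism: `f ∘ γ = δ ∘ f`. -/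
def IsGammaDeltaEndo (γ δ : A₁ K →ₗ[K] A₁ K) (f : A₁ K →ₐ[K] A₁ K) : Prop :=
  f.toLinearMap ∘ₗ γ = δ ∘ₗ f.toLinearMap

/-- `φ` is an `α`-endomorphism: an endomorphism that commutes with `α`. -/
def IsAlphaEndo (φ : A₁ K →ₗ[K] A₁ K) : Prop :=
  IsEndo φ ∧ φ ∘ₗ α K = α K ∘ₗ φ

/-- `φ` is an `α`-anti-endomorphism: an anti-endomorphism that commutes with `α`. -/
def IsAlphaAntiEndo (φ : A₁ K →ₗ[K] A₁ K) : Prop :=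
  IsAntiEndo φ ∧ φ ∘ₗ α K = α K ∘ₗ φ

/-- `h ∘ f ∘ g⁻¹`. -/
def twist (g h : A₁ K ≃ₗ[K] A₁ K) (f : A₁ K →ₐ[K] A₁ K) : A₁ K →ₗ[K] A₁ K :=
  h.toLinearMap ∘ₗ f.toLinearMap ∘ₗ g.symm.toLinearMap

/-! ## `α` is the exchange involution -/

theorem α_X : α K (X K) = Y K := by
  simp [α, exchangeOp, lift_X]

theorem α_Y : α K (Y K) = X K := by
  simp [α, exchangeOp, lift_Y]

theorem isAntiEndo_α : IsAntiEndo (α K) :=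
  ⟨exchangeOp K, fun a => by simp [α]⟩

theorem isInvolution_α : IsInvolution (α K) := by
  refine ⟨isAntiEndo_α, ?_⟩
  have hmul : ∀ a b, α K (a * b) = α K b * α K a := fun a b => by simp [α]
  have hone : α K 1 = 1 := by simp [α]
  let F : A₁ K →ₐ[K] A₁ K :=
    AlgHom.ofLinearMap (α K ∘ₗ α K) (by simp [hone]) (fun a b => by simp [hmul])
  have hF : F = AlgHom.id K (A₁ K) := by
    apply RingQuot.ringQuot_ext'
    apply FreeAlgebra.hom_ext
    funext i
    fin_cases i
    · change α K (α K (X K)) = X K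
      rw [α_X, α_Y]
    · change α K (α K (Y K)) = Y K
      rw [α_Y, α_X]
  ext a
  exact DFunLike.congr_fun hF a

/-! ## The three conjectures -/

variable (K)

/-- The Dixmier conjecture for `A₁(K)`: every algebra endomorphism of `A₁(K)` is an
automorphism. -/
def DixmierConjecture : Prop :=
  ∀ f : A₁ K →ₐ[K] A₁ K, Function.Bijective f

/-- The `γ,δ` conjecture: for every endomorphism `f` of `A₁(K)` there are involutions `γ` and
`δ`, each of them conjugate to `α`, such that `f` is a `γ,δ`-endomorphism. -/
def GammaDeltaConjecture : Prop :=
  ∀ f : A₁ K →ₐ[K] A₁ K, ∃ γ δ : A₁ K →ₗ[K] A₁ K,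
    IsInvolution γ ∧ IsInvolution δ ∧
    IsConjugateToExchange γ ∧ IsConjugateToExchange δ ∧
    IsGammaDeltaEndo γ δ f

/-- The `g,h` conjecture: for every endomorphism `f` of `A₁(K)` there are `g` and `h`, each an
automorphism or an anti-automorphism, such that `h f g⁻¹` is an `α`-endomorphism (if `g` and `h`
are of the same kind) or an `α`-anti-endomorphism (if they are of different kinds). -/
def GHConjecture : Prop :=
  ∀ f : A₁ K →ₐ[K] A₁ K, ∃ g h : A₁ K ≃ₗ[K] A₁ K,
    (((IsAuto g ∧ IsAuto h) ∨ (IsAntiAuto g ∧ IsAntiAuto h)) ∧ IsAlphaEndo (twist g h f)) ∨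
    (((IsAuto g ∧ IsAntiAuto h) ∨ (IsAntiAuto g ∧ IsAuto h)) ∧ IsAlphaAntiEndo (twist g h f))

end

end DixmierA1

/-! The formal implications come from conjugation. If γ = g⁻¹αg and δ = h⁻¹αh, then fγ = δf says
exactly that hfg⁻¹ commutes with α, so (GD) gives (GH). If f is bijective, γ = α and δ = fαf⁻¹ work,
so (D) gives (GD). What remains is (GH) ⇒ (D), which rests on one theorem: every α-endomorphism is
bijective (the anti case follows by composing with α).

In the coordinates x = X + Y, y = (Y - X)/2 the involution fixes x and negates y. An α-endomorphism
sends (x, y) to a pair (S, T) with TS - ST = 1 and T skew. Such a pair is triangular, T = cy and S =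
c⁻¹x + f(y) (`pair_triangular`), and a triangular endomorphism is invertible.

Triangularity reduces to the bounds deg_x S ≤ 1 and deg_x T ≤ 0 (`pair_degree_le`), obtained by
reduction modulo a large prime p. All coefficients lie in a finitely generated ring R. Modulo p the
center of the Weyl algebra consists of the polynomials in x^p and y^p (`exists_frob_of_mem_center`),
and S^p, T^p are central (`pair_pow_mem_center`), so they become bivariate polynomials P, Q.
Commutators over R divided by p induce the Poisson bracket on the center, and {Q, P} = 1
(`poisson_eq_one`). Since T is skew and p is odd, Q is odd in y, hence vanishes on the axis y = 0.
For degrees small against p, a Newton polygon argument then makes (P, Q) triangular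
(`keller_triangular`). The degree bounds pass back to S and T modulo p; a coefficient violating them
in characteristic zero is made invertible in R, so it would survive the reduction. -/

namespace Weyl

open Polynomial

universe v

/-- The relation `Y X = X Y + 1` over a commutative ring. -/
inductive Rel (R : Type u) [CommRing R] :
    FreeAlgebra R (Fin 2) → FreeAlgebra R (Fin 2) → Prop
  | comm : Rel R (FreeAlgebra.ι R 1 * FreeAlgebra.ι R 0)
      (FreeAlgebra.ι R 0 * FreeAlgebra.ι R 1 + 1)

/-- The first Weyl algebra over a commutative ring. -/
def W (R : Type u) [CommRing R] : Type u := RingQuot (Rel R)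

set_option linter.unusedSectionVars false

noncomputable section

/-! ### The Weyl algebra over a commutative ring: presentation and universal property -/

section basic

variable (R : Type u) [CommRing R]

instance : Ring (W R) := inferInstanceAs (Ring (RingQuot (Rel R)))
instance : Algebra R (W R) := inferInstanceAs (Algebra R (RingQuot (Rel R)))

/-- The first generator. -/
def x : W R := RingQuot.mkAlgHom R (Rel R) (FreeAlgebra.ι R 0)

/-- The second generator. -/
def y : W R := RingQuot.mkAlgHom R (Rel R) (FreeAlgebra.ι R 1)

theorem y_mul_x : y R * x R = x R * y R + 1 := by
  have h := RingQuot.mkAlgHom_rel R (Rel.comm (R := R))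
  simp only [map_mul, map_add, map_one] at h
  exact h

variable {R}

/-- The universal property of the Weyl algebra. -/
def lift {A : Type v} [Ring A] [Algebra R A] (p q : A) (h : q * p = p * q + 1) : W R →ₐ[R] A :=
  RingQuot.liftAlgHom R ⟨FreeAlgebra.lift R ![p, q], by
    rintro _ _ ⟨⟩
    simpa using h⟩

section lift
variable {A : Type v} [Ring A] [Algebra R A] (p q : A) (h : q * p = p * q + 1)

@[simp] theorem lift_x : lift p q h (x R) = p :=
  (RingQuot.liftAlgHom_mkAlgHom_apply (S := R) (s := Rel R) _ _ _).trans (by simp)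

@[simp] theorem lift_y : lift p q h (y R) = q :=
  (RingQuot.liftAlgHom_mkAlgHom_apply (S := R) (s := Rel R) _ _ _).trans (by simp)

end lift

theorem algHom_ext {A : Type v} [Semiring A] [Algebra R A] {f g : W R →ₐ[R] A}
    (hx : f (x R) = g (x R)) (hy : f (y R) = g (y R)) : f = g := by
  refine RingQuot.ringQuot_ext' (S := R) (s := Rel R) f g (FreeAlgebra.hom_ext ?_)
  funext i
  fin_cases i
  · exact hx
  · exact hy

/-- The universal property yields a map into `B` whose composite with the inclusion is the identity.
-/
theorem mem_of_generators (B : Subalgebra R (W R)) (hx : x R ∈ B) (hy : y R ∈ B) (a : W R) :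
    a ∈ B := by
  let F : W R →ₐ[R] B := lift ⟨x R, hx⟩ ⟨y R, hy⟩ (Subtype.ext (y_mul_x R))
  have hF : B.val.comp F = AlgHom.id R (W R) := algHom_ext (by simp [F]) (by simp [F])
  have h : B.val (F a) = a := DFunLike.congr_fun hF a
  have h2 : B.val (F a) ∈ B := (F a).2
  rwa [h] at h2

/-- Induction along sums and products of the generators. -/
theorem generator_induction {P : W R → Prop} (hr : ∀ r, P (algebraMap R _ r)) (hx : P (x R))
    (hy : P (y R)) (hadd : ∀ a b, P a → P b → P (a + b)) (hmul : ∀ a b, P a → P b → P (a * b))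
    (a : W R) : P a :=
  mem_of_generators
    { carrier := {a | P a}
      mul_mem' := fun {a b} => hmul a b
      add_mem' := fun {a b} => hadd a b
      algebraMap_mem' := hr } hx hy a

theorem ringHom_ext {A : Type v} [Semiring A] {f g : W R →+* A}
    (hr : ∀ r, f (algebraMap R _ r) = g (algebraMap R _ r))
    (hx : f (x R) = g (x R)) (hy : f (y R) = g (y R)) : f = g :=
  RingHom.ext <| generator_induction hr hx hy
    (fun a b ha hb => by rw [map_add, map_add, ha, hb])
    (fun a b ha hb => by rw [map_mul, map_mul, ha, hb])

/-! ### Normal ordering -/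

variable (R) in
/-- The action of the second generator on the left regular representation. -/
def yEnd : R[X][X] →ₗ[R] R[X][X] :=
  LinearMap.mulLeft R (C X) + (derivative (R := R[X])).restrictScalars R

theorem yEnd_apply (m : R[X][X]) : yEnd R m = C X * m + derivative m := rfl

variable (R) in
/-- The left regular representation in normally ordered coordinates; the outer variable stands
for `x`, the inner one for `y`. -/
def rep : W R →ₐ[R] Module.End R R[X][X] :=
  lift (LinearMap.mulLeft R X) (yEnd R) (by
    refine LinearMap.ext fun m => ?_
    simp only [Module.End.mul_apply, LinearMap.mulLeft_apply, yEnd_apply, LinearMap.add_apply,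
      Module.End.one_apply, derivative_mul, derivative_X]
    ring)

@[simp] theorem rep_x (m : R[X][X]) : rep R (x R) m = X * m := by simp [rep]

@[simp] theorem rep_y (m : R[X][X]) : rep R (y R) m = C X * m + derivative m := by
  simp [rep, yEnd_apply]

variable (R) in
/-- The normally ordered element attached to a polynomial. -/
def ofPoly : R[X][X] →ₗ[R] W R :=
  lsum fun i => LinearMap.mulLeft R (x R ^ i) ∘ₗ (aeval (y R)).toLinearMap

theorem ofPoly_monomial (i : ℕ) (f : R[X]) :
    ofPoly R (monomial i f) = x R ^ i * aeval (y R) f := by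
  simp [ofPoly, lsum_apply]

theorem y_mul_x_pow (i : ℕ) :
    y R * x R ^ (i + 1) = x R ^ (i + 1) * y R + (i + 1 : ℕ) * x R ^ i := by
  induction i with
  | zero => simp [y_mul_x]
  | succ i ih =>
    rw [pow_succ, ← mul_assoc, ih, add_mul, mul_assoc, y_mul_x, mul_assoc (Nat.cast _), ← pow_succ]
    push_cast
    noncomm_ring

theorem ofPoly_X_mul (m : R[X][X]) : ofPoly R (X * m) = x R * ofPoly R m := by
  induction m using Polynomial.induction_on' with
  | add p q hp hq => simp [mul_add, hp, hq]
  | monomial i f => rw [X_mul_monomial, ofPoly_monomial, ofPoly_monomial, pow_succ', mul_assoc]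

theorem ofPoly_yEnd (m : R[X][X]) : ofPoly R (yEnd R m) = y R * ofPoly R m := by
  induction m using Polynomial.induction_on' with
  | add p q hp hq => simp only [map_add, mul_add, hp, hq]
  | monomial i f =>
    rw [yEnd_apply, C_mul_monomial, map_add, derivative_monomial, ofPoly_monomial,
      ofPoly_monomial, ofPoly_monomial]
    rcases i with _ | i
    · simp
    · rw [← mul_assoc (y R), y_mul_x_pow]
      simp only [map_mul, aeval_X, map_natCast, Nat.add_sub_cancel, add_mul]
      rw [mul_assoc, (Nat.cast_commute (i + 1) (x R ^ i)).eq, mul_assoc,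
        (Nat.cast_commute (i + 1) (aeval (y R) f)).eq]

/-- `ofPoly` intertwines the representation with left multiplication; at `m = 1` this makes it a
left inverse of `symb`. -/
theorem ofPoly_rep (a : W R) (m : R[X][X]) : ofPoly R (rep R a m) = a * ofPoly R m := by
  induction a using generator_induction generalizing m with
  | hr r => rw [AlgHom.commutes, Module.algebraMap_end_apply, map_smul, Algebra.smul_def]
  | hx => rw [rep_x, ofPoly_X_mul]
  | hy => rw [rep_y, ← yEnd_apply, ofPoly_yEnd]
  | hadd a b ha hb => rw [map_add, LinearMap.add_apply, map_add, ha, hb, add_mul]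
  | hmul a b ha hb => rw [map_mul, Module.End.mul_apply, ha, hb, mul_assoc]

theorem ofPoly_one : ofPoly R 1 = 1 := by
  rw [← monomial_zero_one, ofPoly_monomial]; simp

/-- In normal order, multiplication by `C g` is right multiplication by g(y), which commutes with
every left multiplication. -/
theorem rep_C_mul (a : W R) (g : R[X]) (m : R[X][X]) :
    rep R a (C g * m) = C g * rep R a m := by
  induction a using generator_induction generalizing m with
  | hr r =>
    rw [AlgHom.commutes, Module.algebraMap_end_apply, Module.algebraMap_end_apply, mul_smul_comm]
  | hx => rw [rep_x, rep_x]; ring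
  | hy => rw [rep_y, rep_y, derivative_mul, derivative_C]; ring
  | hadd a b ha hb => simp only [map_add, LinearMap.add_apply, ha, hb, mul_add]
  | hmul a b ha hb => simp only [map_mul, Module.End.mul_apply, ha, hb]

/-- The normally ordered symbol of an element of the Weyl algebra. -/
def symb : W R →ₗ[R] R[X][X] := LinearMap.applyₗ (1 : R[X][X]) ∘ₗ (rep R).toLinearMap

theorem symb_apply (a : W R) : symb a = rep R a 1 := rfl

@[simp] theorem ofPoly_symb (a : W R) : ofPoly R (symb a) = a := by
  rw [symb_apply, ofPoly_rep, ofPoly_one, mul_one]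

theorem symb_mul (a b : W R) : symb (a * b) = rep R a (symb b) := by
  rw [symb_apply, map_mul, Module.End.mul_apply, symb_apply]

@[simp] theorem symb_one : symb (1 : W R) = 1 := by
  rw [symb_apply, map_one (rep R), Module.End.one_apply]

theorem symb_x_mul (a : W R) : symb (x R * a) = X * symb a := by rw [symb_mul, rep_x]

theorem symb_x_pow_mul (n : ℕ) (a : W R) : symb (x R ^ n * a) = X ^ n * symb a := by
  induction n with
  | zero => simp
  | succ n ih => rw [pow_succ', mul_assoc, symb_x_mul, ih]; ring

theorem symb_mul_y (a : W R) : symb (a * y R) = C X * symb a := by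
  have h : symb (y R) = C X * 1 := by rw [symb_apply, rep_y]; simp
  rw [symb_mul, h, rep_C_mul, symb_apply]

theorem symb_aeval_y (f : R[X]) : symb (aeval (y R) f) = C f := by
  induction f using Polynomial.induction_on with
  | C r =>
    rw [aeval_C, Algebra.algebraMap_eq_smul_one, map_smul, symb_one]
    rw [← C_1, ← C_1, smul_C, smul_C, smul_eq_mul, mul_one]
  | add p q hp hq => rw [map_add, map_add, hp, hq, C_add]
  | monomial n r h =>
    rw [pow_succ, ← mul_assoc, map_mul _ _ X, aeval_X, symb_mul_y, h, ← C_mul, mul_comm X]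

@[simp] theorem symb_ofPoly (m : R[X][X]) : symb (ofPoly R m) = m := by
  induction m using Polynomial.induction_on' with
  | add p q hp hq => rw [map_add, map_add, hp, hq]
  | monomial i f =>
    rw [ofPoly_monomial, symb_x_pow_mul, symb_aeval_y, ← C_mul_X_pow_eq_monomial, mul_comm]

theorem symb_injective : Function.Injective (symb (R := R)) := fun a b h => by
  rw [← ofPoly_symb a, h, ofPoly_symb]

/-- Commutation with `x` differentiates the coefficients. -/
theorem commutator_x (i : ℕ) (f : R[X]) :
    ofPoly R (monomial i f) * x R - x R * ofPoly R (monomial i f) =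
      ofPoly R (monomial i (derivative f)) := by
  have h : aeval (y R) f * x R - x R * aeval (y R) f = aeval (y R) (derivative f) := by
    induction f using Polynomial.induction_on with
    | C r => rw [aeval_C, derivative_C, map_zero, Algebra.commutes, sub_self]
    | add p q hp hq => rw [map_add, derivative_add, map_add, ← hp, ← hq]; noncomm_ring
    | monomial n r h =>
      rw [pow_succ, ← mul_assoc, map_mul _ _ X, derivative_mul, map_add, map_mul _ _ X, ← h,
        aeval_X, derivative_X, mul_one, mul_assoc _ (y R), y_mul_x]
      noncomm_ring
  rw [ofPoly_monomial, ofPoly_monomial, ← h, mul_sub, mul_assoc, ← mul_assoc (x R), ← pow_succ',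
    pow_succ, mul_assoc (x R ^ i) (x R)]

/-! ### Functoriality -/

section map
variable {B : Type v} [CommRing B] (g : R →+* B)

/-- The homomorphism of Weyl algebras induced by a homomorphism of coefficients. -/
def map : W R →+* W B :=
  -- `W B` is viewed as an `R`-algebra through `g`, so that the universal property over `R` applies.
  letI : Algebra R (W B) := ((algebraMap B (W B)).comp g).toAlgebra' fun r a =>
    Algebra.commutes (g r) a
  (lift (R := R) (x B) (y B) (y_mul_x B)).toRingHom

@[simp] theorem map_algebraMap (r : R) : map g (algebraMap R _ r) = algebraMap B _ (g r) :=
  letI : Algebra R (W B) := ((algebraMap B (W B)).comp g).toAlgebra' fun r a =>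
    Algebra.commutes (g r) a
  (lift (R := R) (x B) (y B) (y_mul_x B)).commutes r

@[simp] theorem map_x : map g (x R) = x B :=
  letI : Algebra R (W B) := ((algebraMap B (W B)).comp g).toAlgebra' fun r a =>
    Algebra.commutes (g r) a
  lift_x (R := R) (x B) (y B) (y_mul_x B)

@[simp] theorem map_y : map g (y R) = y B :=
  letI : Algebra R (W B) := ((algebraMap B (W B)).comp g).toAlgebra' fun r a =>
    Algebra.commutes (g r) a
  lift_y (R := R) (x B) (y B) (y_mul_x B)

theorem map_ofPoly (m : R[X][X]) :
    map g (ofPoly R m) = ofPoly B (m.map (mapRingHom g)) := by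
  have h : ∀ f : R[X], map g (aeval (y R) f) = aeval (y B) (f.map g) := fun f => by
    induction f using Polynomial.induction_on with
    | C r => simp
    | add p q hp hq => simp [hp, hq]
    | monomial n r h => simp
  induction m using Polynomial.induction_on' with
  | add p q hp hq => simp [hp, hq]
  | monomial i f => simp [ofPoly_monomial, h]

theorem symb_map (a : W R) : symb (map g a) = (symb a).map (mapRingHom g) := by
  rw [← symb_ofPoly ((symb a).map (mapRingHom g)), ← map_ofPoly, ofPoly_symb]

end map

end basic

section degree
variable {R : Type u} [CommRing R]

/-! ### Degree estimates -/

/-- The derivative in the action of y lowers the x-degree, so in top degree only multiplication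
survives and leading coefficients multiply as in a commutative ring. -/
theorem rep_aeval_y_top (f : R[X]) (m : R[X][X]) (k : ℕ) (hm : m.natDegree ≤ k) :
    (rep R (aeval (y R) f) m).natDegree ≤ k ∧
      (rep R (aeval (y R) f) m).coeff k = f * m.coeff k := by
  induction f using Polynomial.induction_on generalizing m with
  | C r =>
    rw [aeval_C, AlgHom.commutes, Module.algebraMap_end_apply, coeff_smul, smul_eq_C_mul]
    exact ⟨(natDegree_smul_le r m).trans hm, rfl⟩
  | add p q hp hq =>
    obtain ⟨h1, h2⟩ := hp m hm
    obtain ⟨h3, h4⟩ := hq m hm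
    simp only [map_add, LinearMap.add_apply, coeff_add, h2, h4, add_mul, and_true]
    exact natDegree_add_le_of_degree_le h1 h3
  | monomial n r h =>
    have hd : (C X * m + derivative m).natDegree ≤ k :=
      natDegree_add_le_of_degree_le ((natDegree_C_mul_le _ _).trans hm)
        ((natDegree_derivative_le m).trans ((Nat.sub_le _ _).trans hm))
    obtain ⟨h1, h2⟩ := h _ hd
    rw [pow_succ, ← mul_assoc, map_mul _ _ X, aeval_X, map_mul (rep R), Module.End.mul_apply,
      rep_y]
    refine ⟨h1, ?_⟩
    rw [h2, coeff_add, coeff_C_mul, coeff_derivative,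
      coeff_eq_zero_of_natDegree_lt (lt_of_le_of_lt hm (Nat.lt_succ_self k))]
    ring

theorem rep_ofPoly_top (F m : R[X][X]) (n k : ℕ) (hF : F.natDegree ≤ n) (hm : m.natDegree ≤ k) :
    (rep R (ofPoly R F) m).natDegree ≤ n + k ∧
      (rep R (ofPoly R F) m).coeff (n + k) = F.coeff n * m.coeff k := by
  refine Polynomial.induction_with_natDegree_le
    (fun F => (rep R (ofPoly R F) m).natDegree ≤ n + k ∧
      (rep R (ofPoly R F) m).coeff (n + k) = F.coeff n * m.coeff k) n (by simp)
    (fun i f _ hi => ?_) (fun p q _ hq hp' hq' => ?_) F hF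
  · show _ ∧ _
    obtain ⟨h1, h2⟩ := rep_aeval_y_top f m k hm
    have h3 : rep R (ofPoly R (C f * X ^ i)) m = X ^ i * rep R (aeval (y R) f) m := by
      rw [C_mul_X_pow_eq_monomial, ofPoly_monomial, map_mul, Module.End.mul_apply]
      generalize rep R (aeval (y R) f) m = m'
      clear h1 h2 hi
      induction i with
      | zero => simp
      | succ i ih => rw [pow_succ', map_mul, Module.End.mul_apply, ih, rep_x]; ring
    rw [h3]
    refine ⟨natDegree_mul_le.trans (add_le_add ((natDegree_X_pow_le i).trans hi) h1), ?_⟩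
    rw [coeff_C_mul, coeff_X_pow]
    rcases hi.eq_or_lt with rfl | hi
    · rw [add_comm, coeff_X_pow_mul, h2]; simp
    · rw [if_neg hi.ne', mul_zero, zero_mul]
      refine coeff_eq_zero_of_natDegree_lt (natDegree_mul_le.trans_lt ?_)
      have := natDegree_X_pow_le (R := R[X]) i
      omega
  · obtain ⟨h1, h2⟩ := hp'
    obtain ⟨h3, h4⟩ := hq'
    show _ ∧ _
    simp only [map_add, LinearMap.add_apply, coeff_add, h2, h4, add_mul, and_true]
    exact natDegree_add_le_of_degree_le h1 h3

theorem symb_mul_top (a b : W R) (n k : ℕ) (ha : (symb a).natDegree ≤ n)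
    (hb : (symb b).natDegree ≤ k) :
    (symb (a * b)).natDegree ≤ n + k ∧
      (symb (a * b)).coeff (n + k) = (symb a).coeff n * (symb b).coeff k := by
  have h := rep_ofPoly_top (symb a) (symb b) n k ha hb
  rwa [ofPoly_symb, ← symb_mul] at h

theorem symb_pow_top (a : W R) (n N : ℕ) (ha : (symb a).natDegree ≤ n) :
    (symb (a ^ N)).natDegree ≤ N * n ∧ (symb (a ^ N)).coeff (N * n) = (symb a).coeff n ^ N := by
  induction N with
  | zero => simp
  | succ N ih =>
    have h := symb_mul_top (a ^ N) a _ _ ih.1 ha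
    rw [pow_succ, pow_succ, Nat.succ_mul, h.2, ih.2]
    exact ⟨h.1, rfl⟩

/-- The inner degree of a bivariate polynomial is at most `e`. -/
def InnerDegLE (m : R[X][X]) (e : ℕ) : Prop := ∀ i, (m.coeff i).natDegree ≤ e

theorem InnerDegLE.add {m m' : R[X][X]} {e : ℕ} (h : InnerDegLE m e) (h' : InnerDegLE m' e) :
    InnerDegLE (m + m') e := fun i => by
  rw [coeff_add]; exact natDegree_add_le_of_degree_le (h i) (h' i)

theorem InnerDegLE.rep_aeval_y {m : R[X][X]} {e : ℕ} (h : InnerDegLE m e) (f : R[X]) (d : ℕ)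
    (hf : f.natDegree ≤ d) : InnerDegLE (rep R (aeval (y R) f) m) (d + e) := by
  refine Polynomial.induction_with_natDegree_le
    (fun f => InnerDegLE (rep R (aeval (y R) f) m) (d + e)) d (by simp [InnerDegLE])
    (fun i r _ hi => ?_) (fun p q _ hq hp' hq' => ?_) f hf
  · have key : InnerDegLE (rep R (y R ^ i) m) (i + e) := by
      clear hi
      induction i with
      | zero => simpa using h
      | succ i ih =>
        rw [pow_succ', map_mul, Module.End.mul_apply, rep_y]
        refine InnerDegLE.add (fun j => ?_) (fun j => ?_)
        · rw [coeff_C_mul]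
          refine natDegree_mul_le.trans ?_
          have := natDegree_X_le (R := R)
          have := ih j
          omega
        · rw [coeff_derivative, ← Nat.cast_succ, ← C_eq_natCast]
          refine (natDegree_mul_C_le _ _).trans ((ih _).trans ?_)
          omega
    rw [map_mul, aeval_C, map_pow, aeval_X, map_mul, Module.End.mul_apply, AlgHom.commutes,
      Module.algebraMap_end_apply]
    intro j
    rw [coeff_smul]
    exact (natDegree_smul_le _ _).trans ((key j).trans (by omega))
  · rw [map_add, map_add, LinearMap.add_apply]
    exact hp'.add hq'

theorem InnerDegLE.symb_mul {a b : W R} {d e : ℕ} (ha : InnerDegLE (symb a) d)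
    (hb : InnerDegLE (symb b) e) : InnerDegLE (symb (a * b)) (d + e) := by
  have hX : ∀ (n : ℕ) (m : R[X][X]) (e : ℕ), InnerDegLE m e → InnerDegLE (X ^ n * m) e := by
    intro n m e h i
    rw [coeff_X_pow_mul']
    split_ifs
    · exact h _
    · simp
  have hs : ∀ (s : Finset ℕ), InnerDegLE (symb ((∑ i ∈ s, x R ^ i * aeval (y R)
      ((symb a).coeff i)) * b)) (d + e) := by
    intro s
    induction s using Finset.induction_on with
    | empty => simp [InnerDegLE]
    | insert i s hi ih =>
      rw [Finset.sum_insert hi, add_mul, map_add]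
      refine InnerDegLE.add ?_ ih
      rw [mul_assoc, symb_x_pow_mul, Weyl.symb_mul]
      exact hX _ _ _ (hb.rep_aeval_y _ _ (ha i))
  have h := hs (symb a).support
  have ha' : ∑ i ∈ (symb a).support, x R ^ i * aeval (y R) ((symb a).coeff i) = a := by
    conv_rhs => rw [← ofPoly_symb a, (symb a).as_sum_support]
    simp only [map_sum, ofPoly_monomial]
  rwa [ha'] at h

theorem InnerDegLE.symb_pow {a : W R} {d : ℕ} (ha : InnerDegLE (symb a) d) (N : ℕ) :
    InnerDegLE (symb (a ^ N)) (N * d) := by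
  induction N with
  | zero =>
    intro i
    simp [coeff_one, apply_ite natDegree]
  | succ N ih => rw [pow_succ, Nat.succ_mul]; exact ih.symb_mul ha

end degree

/-! ### Weyl pairs -/

section pair
variable {A : Type v} [Ring A] {S T : A} (h : T * S = S * T + 1)
include h

theorem pair_mul_pow (n : ℕ) : T * S ^ n = S ^ n * T + n * S ^ (n - 1) := by
  induction n with
  | zero => simp
  | succ n ih =>
    rw [pow_succ, ← mul_assoc, ih, add_mul, mul_assoc, h, Nat.add_sub_cancel, mul_assoc (n : A)]
    rcases n with _ | n
    · simp
    · rw [Nat.add_sub_cancel, ← pow_succ]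
      push_cast
      noncomm_ring

/-- The rotation (S, T) ↦ (T, -S) preserves Weyl pairs; it transfers statements about the first
member to the second. -/
theorem pair_neg_swap : -S * T = T * -S + 1 := by
  rw [mul_neg, h]; noncomm_ring

variable {p : ℕ} (hp : p.Prime) (hA : (p : A) = 0)
include hp hA

omit h in
-- By Bézout, `i` is invertible modulo `p`.
theorem eq_zero_of_natCast_mul {i : ℕ} (hi0 : i ≠ 0) (hi : i < p) {a : A} (ha : (i : A) * a = 0) :
    a = 0 := by
  have hc : Nat.Coprime i p :=
    ((Nat.Prime.coprime_iff_not_dvd hp).2 fun hd => hi.not_ge (Nat.le_of_dvd (by omega) hd)).symm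
  have hb := Nat.gcd_eq_gcd_ab i p
  rw [hc] at hb
  have hb' := congrArg (fun z : ℤ => (z : A)) hb
  simp only [Nat.cast_one, Int.cast_one, Int.cast_add, Int.cast_mul, Int.cast_natCast, hA,
    zero_mul, add_zero] at hb'
  rw [← one_mul a, hb', (Nat.cast_commute i _).eq, mul_assoc, ha, mul_zero]

theorem pair_pow_commute : Commute (S ^ p) T := by
  have := pair_mul_pow h p
  rw [hA, zero_mul, add_zero] at this
  exact this.symm

/-- Powers of `S` below `p` are independent over the centralizer of `T`. -/
theorem pair_independent (n : ℕ) (hn : n ≤ p) (a : ℕ → A) (ha : ∀ i, Commute T (a i))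
    (hs : ∑ i ∈ Finset.range n, S ^ i * a i = 0) : ∀ i < n, a i = 0 := by
  induction n generalizing a with
  | zero => intro i hi; omega
  | succ n ih =>
    -- Commutation with `T` differentiates the relation in `S` and shortens it; the factors `i + 1 <
    -- p` that appear can be cancelled.
    have h1 : ∑ i ∈ Finset.range n, S ^ i * (((i + 1 : ℕ) : A) * a (i + 1)) = 0 := by
      have h2 : T * (∑ i ∈ Finset.range (n + 1), S ^ i * a i) -
          (∑ i ∈ Finset.range (n + 1), S ^ i * a i) * T = 0 := by rw [hs]; simp
      rw [Finset.mul_sum, Finset.sum_mul, ← Finset.sum_sub_distrib] at h2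
      have h3 : ∀ i, T * (S ^ i * a i) - S ^ i * a i * T = i * S ^ (i - 1) * a i := fun i => by
        rw [← mul_assoc, pair_mul_pow h, mul_assoc _ (a i), ← (ha i).eq]
        noncomm_ring
      simp only [h3] at h2
      rw [Finset.sum_range_succ'] at h2
      simp only [Nat.cast_zero, zero_mul, add_zero, Nat.add_sub_cancel] at h2
      rw [← h2]
      refine Finset.sum_congr rfl fun i _ => ?_
      rw [← mul_assoc, (Nat.cast_commute (i + 1) (S ^ i)).eq]
    have h4 := ih (by omega) (fun i => ((i + 1 : ℕ) : A) * a (i + 1))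
      (fun i => (Nat.cast_commute _ _).symm.mul_right (ha _)) h1
    have h5 : ∀ i < n, a (i + 1) = 0 := fun i hi =>
      eq_zero_of_natCast_mul hp hA (Nat.succ_ne_zero i) (by omega) (h4 i hi)
    intro i hi
    rcases i with _ | i
    · rw [Finset.sum_range_succ', Finset.sum_eq_zero fun i hi => by
        rw [h5 i (Finset.mem_range.1 hi), mul_zero]] at hs
      simpa using hs
    · exact h5 i (by omega)

end pair

/-! ### The center in characteristic `p` -/

section center
variable (p : ℕ) [hp : Fact p.Prime] (B : Type u) [CommRing B] [CharP B p]

theorem natCast_prime_eq_zero : (p : W B) = 0 := by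
  rw [← map_natCast (algebraMap B (W B)), CharP.cast_eq_zero, map_zero]

omit [CharP B p] in
theorem mem_center_of_commute {a : W B} (hx : Commute a (x B)) (hy : Commute a (y B)) :
    a ∈ Subalgebra.center B (W B) := by
  rw [Subalgebra.mem_center_iff]
  intro b
  have : b ∈ Subalgebra.centralizer B {a} :=
    mem_of_generators _ (by simpa [Subalgebra.mem_centralizer_iff] using hx.eq)
      (by simpa [Subalgebra.mem_centralizer_iff] using hy.eq) b
  rw [Subalgebra.mem_centralizer_iff] at this
  exact (this a rfl).symm

theorem x_pow_mem_center : x B ^ p ∈ Subalgebra.center B (W B) :=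
  mem_center_of_commute B ((Commute.refl _).pow_left p)
    (pair_pow_commute (y_mul_x B) hp.out (natCast_prime_eq_zero p B))

theorem y_pow_mem_center : y B ^ p ∈ Subalgebra.center B (W B) := by
  refine mem_center_of_commute B ?_ ((Commute.refl _).pow_left p)
  have := pair_pow_commute (pair_neg_swap (y_mul_x B)) hp.out (natCast_prime_eq_zero p B)
  simpa using this.neg_right

/-- The polynomials in `x ^ p` and `y ^ p`. -/
def centerHom : B[X][X] →+* Subalgebra.center B (W B) :=
  eval₂RingHom (aeval (⟨y B ^ p, y_pow_mem_center p B⟩ : Subalgebra.center B (W B))).toRingHom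
    ⟨x B ^ p, x_pow_mem_center p B⟩

/-- The polynomials in `x ^ p` and `y ^ p`, as elements of the Weyl algebra. -/
def frob : B[X][X] →+* W B := (Subalgebra.center B (W B)).val.toRingHom.comp (centerHom p B)

theorem frob_X : frob p B X = x B ^ p := by simp [frob, centerHom]

theorem frob_C_X : frob p B (C X) = y B ^ p := by simp [frob, centerHom]

theorem frob_C_C (r : B) : frob p B (C (C r)) = algebraMap B _ r := by simp [frob, centerHom]

theorem frob_commute (F : B[X][X]) (a : W B) : Commute (frob p B F) a :=
  ((Subalgebra.mem_center_iff.1 (centerHom p B F).2) a).symm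

omit [CharP B p] in
/-- Substitution of `p`-th powers for both variables. -/
def expand₂ : B[X][X] →+* B[X][X] :=
  (expand B[X] p).toRingHom.comp (mapRingHom (expand B p).toRingHom)

/-- The central y^p may be moved to the far right, where it merely multiplies the symbol. Central
coefficients therefore act on symbols by ordinary multiplication. -/
theorem symb_frob_mul (F : B[X][X]) (a : W B) :
    symb (frob p B F * a) = expand₂ p B F * symb a := by
  induction F using Polynomial.induction_on generalizing a with
  | C f =>
    induction f using Polynomial.induction_on generalizing a with
    | C r => rw [frob_C_C, ← Algebra.smul_def, map_smul]; simp [expand₂, Algebra.smul_def]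
    | add p q hp hq => simp only [map_add, add_mul, hp, hq]
    | monomial n r h =>
      have key : ∀ n (a : W B), symb (a * y B ^ n) = C X ^ n * symb a := by
        intro n a
        induction n with
        | zero => simp
        | succ n ih => rw [pow_succ, ← mul_assoc, symb_mul_y, ih]; ring
      rw [pow_succ, ← mul_assoc, C_mul, map_mul (frob p B), frob_C_X, mul_assoc, h,
        map_mul (expand₂ p B),
        ((Subalgebra.mem_center_iff.1 (y_pow_mem_center p B)) a).symm, key]
      simp [expand₂]
      ring
  | add p q hp hq => simp only [map_add, add_mul, hp, hq]
  | monomial n r h =>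
    rw [pow_succ, ← mul_assoc, map_mul (frob p B), frob_X, mul_assoc, h,
      map_mul (expand₂ p B), symb_x_pow_mul]
    simp [expand₂]
    ring

theorem symb_frob (F : B[X][X]) : symb (frob p B F) = expand₂ p B F := by
  rw [← mul_one (frob p B F), symb_frob_mul, symb_one, mul_one]


omit [CharP B p] in
-- All exponents of the product are congruent to `i` modulo `p`, so residues below `p` separate the
-- summands.
theorem coeff_expand_mul_X_pow {C : Type v} [CommRing C] (f : C[X]) {i i₀ : ℕ} (hi : i < p)
    (hi₀ : i₀ < p) (a : ℕ) :
    (expand C p f * X ^ i).coeff (p * a + i₀) = if i = i₀ then f.coeff a else 0 := by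
  rw [coeff_mul_X_pow']
  rcases lt_trichotomy i i₀ with h | rfl | h
  · rw [if_neg h.ne, if_pos (by omega), coeff_expand hp.out.pos, if_neg]
    rw [Nat.add_sub_assoc h.le, (Nat.dvd_add_right (dvd_mul_right p a))]
    exact fun hd => by have := Nat.le_of_dvd (by omega) hd; omega
  · rw [if_pos rfl, if_pos (by omega), Nat.add_sub_cancel, mul_comm p, coeff_expand_mul hp.out.pos]
  · rw [if_neg h.ne']
    split_ifs with h2
    · rw [coeff_expand hp.out.pos, if_neg]
      intro hd
      rcases a with _ | a
      · omega
      have h3 : p * (a + 1) + i₀ - i = p * a + (p + i₀ - i) := by rw [mul_add]; omega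
      rw [h3, Nat.dvd_add_right (dvd_mul_right p a)] at hd
      have := Nat.le_of_dvd (by omega) hd
      omega
    · rfl

omit [CharP B p] in
theorem coeff_expand₂_mul (F : B[X][X]) {i i₀ j j₀ : ℕ} (hi : i < p) (hi₀ : i₀ < p)
    (hj : j < p) (hj₀ : j₀ < p) (a b : ℕ) :
    ((expand₂ p B F * (X ^ i * C (X ^ j))).coeff (p * a + i₀)).coeff (p * b + j₀) =
      if i = i₀ ∧ j = j₀ then (F.coeff a).coeff b else 0 := by
  have h : expand₂ p B F = expand B[X] p (F.map (expand B p).toRingHom) := rfl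
  rw [← mul_assoc, coeff_mul_C, h, coeff_expand_mul_X_pow p _ hi hi₀, coeff_map]
  by_cases h1 : i = i₀
  · rw [if_pos h1]
    have := coeff_expand_mul_X_pow p (F.coeff a) hj hj₀ b
    simp only [AlgHom.toRingHom_eq_coe, RingHom.coe_coe, h1, true_and]
    exact this
  · simp [h1]

/-- The standard basis of the Weyl algebra over the `p`-th powers of its generators. -/
def stdBasis (k : Fin p × Fin p) : W B := x B ^ (k.1 : ℕ) * y B ^ (k.2 : ℕ)

theorem symb_frob_mul_stdBasis (F : B[X][X]) (k : Fin p × Fin p) :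
    symb (frob p B F * stdBasis p B k) = expand₂ p B F * (X ^ (k.1 : ℕ) * C (X ^ (k.2 : ℕ))) := by
  have h : symb (y B ^ (k.2 : ℕ)) = C (X ^ (k.2 : ℕ)) := by
    rw [← symb_aeval_y, map_pow (aeval (y B)), aeval_X]
  rw [symb_frob_mul, stdBasis, symb_x_pow_mul, h]

theorem stdBasis_independent (c : Fin p × Fin p → B[X][X])
    (hc : ∑ k, frob p B (c k) * stdBasis p B k = 0) : c = 0 := by
  funext k₀
  ext a b
  have h := congrArg (fun w => ((symb w).coeff (p * a + k₀.1)).coeff (p * b + k₀.2)) hc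
  simp only [map_sum, symb_frob_mul_stdBasis, finsetSum_coeff, map_zero, coeff_zero,
    coeff_expand₂_mul p B _ (Fin.is_lt _) (Fin.is_lt _) (Fin.is_lt _) (Fin.is_lt _)] at h
  rw [Finset.sum_eq_single k₀] at h
  · simpa using h
  · intro k _ hk
    rw [if_neg]
    rintro ⟨h1, h2⟩
    exact hk (Prod.ext (Fin.ext h1) (Fin.ext h2))
  · simp

/-- Both exponents of a normally ordered monomial are divided by `p` with remainder. -/
theorem stdBasis_span (w : W B) :
    ∃ c : Fin p × Fin p → B[X][X], w = ∑ k, frob p B (c k) * stdBasis p B k := by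
  obtain ⟨m, rfl⟩ : ∃ m, ofPoly B m = w := ⟨symb w, ofPoly_symb w⟩
  induction m using Polynomial.induction_on' with
  | add f g hf hg =>
    obtain ⟨c, hc⟩ := hf
    obtain ⟨d, hd⟩ := hg
    refine ⟨c + d, ?_⟩
    simp only [map_add, hc, hd, Pi.add_apply, add_mul, Finset.sum_add_distrib]
  | monomial n f =>
    induction f using Polynomial.induction_on' with
    | add f g hf hg =>
      obtain ⟨c, hc⟩ := hf
      obtain ⟨d, hd⟩ := hg
      refine ⟨c + d, ?_⟩
      simp only [map_add, hc, hd, Pi.add_apply, add_mul, Finset.sum_add_distrib]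
    | monomial m r =>
      let k : Fin p × Fin p :=
        (⟨n % p, Nat.mod_lt _ hp.out.pos⟩, ⟨m % p, Nat.mod_lt _ hp.out.pos⟩)
      refine ⟨Pi.single k (C (C r * X ^ (m / p)) * X ^ (n / p)), ?_⟩
      rw [Finset.sum_eq_single k]
      · refine symb_injective ?_
        rw [symb_ofPoly, Pi.single_eq_same, symb_frob_mul_stdBasis]
        simp only [expand₂, RingHom.comp_apply, map_mul, map_pow, coe_mapRingHom, map_C, map_X,
          AlgHom.toRingHom_eq_coe, RingHom.coe_coe, expand_X, expand_C, k]
        rw [← C_mul_X_pow_eq_monomial, ← C_mul_X_pow_eq_monomial, C_mul, C_pow]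
        conv_lhs => rw [← Nat.div_add_mod n p, ← Nat.div_add_mod m p]
        simp only [pow_add, pow_mul]
        ring
      · intro k' _ hk
        rw [Pi.single_eq_of_ne hk, map_zero, zero_mul]
      · simp

theorem frob_injective : Function.Injective (frob p B) := by
  rw [injective_iff_map_eq_zero]
  intro F hF
  let k₀ : Fin p × Fin p := (⟨0, hp.out.pos⟩, ⟨0, hp.out.pos⟩)
  have h := stdBasis_independent p B (Pi.single k₀ F) (by
    refine Finset.sum_eq_zero fun k _ => ?_
    rcases eq_or_ne k k₀ with rfl | hk
    · rw [Pi.single_eq_same, hF, zero_mul]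
    · rw [Pi.single_eq_of_ne hk, map_zero, zero_mul])
  simpa using congrFun h k₀

variable {B}

/-- A central combination of the monomials of a Weyl pair is constant. -/
theorem pair_central_sum {S T : W B} (h : T * S = S * T + 1) (c : Fin p × Fin p → B[X][X])
    {z : W B} (hz : z ∈ Subalgebra.center B (W B))
    (hc : ∑ k, frob p B (c k) * (S ^ (k.1 : ℕ) * T ^ (k.2 : ℕ)) = z) (k : Fin p × Fin p) :
    frob p B (c k) = if (k.1 : ℕ) = 0 ∧ (k.2 : ℕ) = 0 then z else 0 := by
  have hA := natCast_prime_eq_zero p B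
  have hz' : ∀ w, Commute w z := fun w => (Subalgebra.mem_center_iff.1 hz) w
  -- Subtracting `z` from the constant coefficient turns the hypothesis into a vanishing relation.
  let e : ℕ → ℕ → W B := fun i j =>
    (if hh : i < p ∧ j < p then frob p B (c (⟨i, hh.1⟩, ⟨j, hh.2⟩)) else 0) -
      if i = 0 ∧ j = 0 then z else 0
  have he : ∀ i j w, Commute w (e i j) := by
    intro i j w
    refine Commute.sub_right ?_ ?_
    · split_ifs
      · exact (frob_commute p B _ _).symm
      · exact Commute.zero_right _
    · split_ifs
      · exact hz' w
      · exact Commute.zero_right _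
  let a : ℕ → W B := fun i => ∑ j ∈ Finset.range p, T ^ j * e i j
  have ha : ∀ i, Commute T (a i) := fun i =>
    Commute.sum_right _ _ _ fun j _ => ((Commute.refl T).pow_right j).mul_right (he i j T)
  have hsum : ∑ i ∈ Finset.range p, S ^ i * a i = 0 := by
    rw [← sub_eq_zero.2 hc, Fintype.sum_prod_type]
    have h1 : ∀ i j : Fin p, frob p B (c (i, j)) * (S ^ (i : ℕ) * T ^ (j : ℕ)) =
        S ^ (i : ℕ) * (T ^ (j : ℕ) * e i j) +
          if (i : ℕ) = 0 ∧ (j : ℕ) = 0 then z else 0 := by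
      intro i j
      simp only [e, Fin.is_lt, and_self, dite_true, Fin.eta]
      rw [(frob_commute p B (c (i, j)) (S ^ (i : ℕ) * T ^ (j : ℕ))).eq, mul_sub, mul_sub,
        mul_assoc]
      split_ifs with h2
      · rw [h2.1, h2.2]; simp
      · simp
    have h2 : ∑ i : Fin p, ∑ j : Fin p, (if (i : ℕ) = 0 ∧ (j : ℕ) = 0 then z else 0) = z := by
      rw [Finset.sum_eq_single ⟨0, hp.out.pos⟩, Finset.sum_eq_single ⟨0, hp.out.pos⟩]
      · simp
      · intro j _ hj
        exact if_neg fun hh => hj (Fin.ext hh.2)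
      · simp
      · intro i _ hi
        exact Finset.sum_eq_zero fun j _ => if_neg fun hh => hi (Fin.ext hh.1)
      · simp
    simp only [h1, Finset.sum_add_distrib, h2, add_sub_cancel_right]
    simp only [a, Finset.sum_range, Finset.mul_sum]
  -- Independence is used once for the powers of `S`, then for the powers of `T` through the rotated
  -- pair (T, -S).
  have h1 := pair_independent h hp.out hA p le_rfl a ha hsum
  have h2 := pair_independent (pair_neg_swap h) hp.out hA p le_rfl
    (fun j => e k.1 j) (fun j => he _ _ _) (h1 k.1 k.1.2) k.2 k.2.2
  simp only [e, Fin.is_lt, and_self, dite_true, Fin.eta, Prod.mk.eta] at h2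
  exact sub_eq_zero.1 h2

theorem exists_frob_of_mem_center {z : W B} (hz : z ∈ Subalgebra.center B (W B)) :
    ∃ F, frob p B F = z := by
  obtain ⟨c, hc⟩ := stdBasis_span p B z
  exact ⟨_, (pair_central_sum p (y_mul_x B) c hz hc.symm
    (⟨0, hp.out.pos⟩, ⟨0, hp.out.pos⟩)).trans (if_pos ⟨rfl, rfl⟩)⟩

/-- In characteristic `p` the `p`-th power of the first member of a Weyl pair is central. -/
theorem pair_pow_mem_center {S T : W B} (h : T * S = S * T + 1) :
    S ^ p ∈ Subalgebra.center B (W B) := by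
  have hA := natCast_prime_eq_zero p B
  let v : Fin p × Fin p → W B := fun k => S ^ (k.1 : ℕ) * T ^ (k.2 : ℕ)
  have hind : ∀ c : Fin p × Fin p → B[X][X], ∑ k, frob p B (c k) * v k = 0 → c = 0 := by
    intro c hc
    funext k
    have h1 := pair_central_sum p h c (Subalgebra.zero_mem _) hc k
    rw [ite_self] at h1
    exact frob_injective p B (h1.trans (map_zero _).symm)
  -- The rows of `M` express the monomials S^i T^j in the standard basis. Over a ring with zero
  -- divisors `M` need not be invertible, but independence makes its determinant a nonzerodivisor,
  -- and the adjugate replaces the inverse.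
  choose M hM using fun k => stdBasis_span p B (v k)
  let M' : Matrix (Fin p × Fin p) (Fin p × Fin p) B[X][X] := Matrix.of M
  have hM' : M'.Nonsingular := by
    refine Matrix.Nonsingular.of_linearIndependent_row ?_
    rw [← Matrix.vecMul_injective_iff]
    refine fun c d hcd => sub_eq_zero.1 (hind (c - d) ?_)
    have h5 : Matrix.vecMul (c - d) M' = 0 := by rw [Matrix.sub_vecMul]; exact sub_eq_zero.2 hcd
    simp only [hM, Finset.mul_sum]
    rw [Finset.sum_comm]
    refine Finset.sum_eq_zero fun l _ => ?_
    simp only [← mul_assoc, ← Finset.sum_mul, ← map_mul, ← map_sum]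
    have h6 := congrFun h5 l
    simp only [Matrix.vecMul, dotProduct] at h6
    have h7 : ∑ i, (c - d) i * M i l = 0 := h6
    rw [h7, map_zero, zero_mul]
  rw [Matrix.nonsingular_iff_det_mem_nonZeroDivisors] at hM'
  -- `S ^ p` commutes with every S^i T^j, hence with det · (basis element); the determinant is then
  -- cancelled.
  have hcomm : ∀ l, Commute (S ^ p) (stdBasis p B l) := by
    intro l
    have hz : ∀ k, Commute (S ^ p) (v k) := fun k =>
      (((Commute.refl S).pow_left p).pow_right _).mul_right ((pair_pow_commute h hp.out hA).pow_right _)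
    have hdet : frob p B M'.det * stdBasis p B l = ∑ k, frob p B (M'.adjugate l k) * v k := by
      have h8 := Matrix.adjugate_mul M'
      simp only [hM, Finset.mul_sum]
      rw [Finset.sum_comm]
      simp only [← mul_assoc, ← Finset.sum_mul, ← map_mul, ← map_sum]
      have h9 : ∀ i, ∑ k, M'.adjugate l k * M k i = if l = i then M'.det else 0 := fun i => by
        have := congrFun (congrFun h8 l) i
        rw [Matrix.mul_apply] at this
        rw [show (∑ k, M'.adjugate l k * M k i) = ∑ k, M'.adjugate l k * M' k i from rfl, this,
          Matrix.smul_apply, Matrix.one_apply]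
        simp
      simp only [h9]
      rw [Finset.sum_eq_single l]
      · simp
      · intro i _ hi
        rw [if_neg hi.symm, map_zero, zero_mul]
      · simp
    have hdc : Commute (S ^ p) (frob p B M'.det * stdBasis p B l) := by
      rw [hdet]
      exact Commute.sum_right _ _ _ fun k _ => ((frob_commute p B _ _).symm).mul_right (hz k)
    have hzero : frob p B M'.det * (S ^ p * stdBasis p B l - stdBasis p B l * S ^ p) = 0 := by
      rw [mul_sub, ← mul_assoc, (frob_commute p B M'.det (S ^ p)).eq, mul_assoc, hdc.eq]
      noncomm_ring
    obtain ⟨c, hc⟩ := stdBasis_span p B (S ^ p * stdBasis p B l - stdBasis p B l * S ^ p)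
    rw [hc, Finset.mul_sum] at hzero
    simp only [← mul_assoc, ← map_mul] at hzero
    have h10 := stdBasis_independent p B (fun k => M'.det * c k) hzero
    have h11 : c = 0 := funext fun k =>
      (mem_nonZeroDivisors_iff_left.1 hM') _ (congrFun h10 k)
    rw [h11] at hc
    simp only [Pi.zero_apply, map_zero, zero_mul, Finset.sum_const_zero] at hc
    exact sub_eq_zero.1 hc
  have h1p := hp.out.one_lt
  refine mem_center_of_commute B ?_ ?_
  · simpa [stdBasis] using hcomm (⟨1, h1p⟩, ⟨0, hp.out.pos⟩)
  · simpa [stdBasis] using hcomm (⟨0, hp.out.pos⟩, ⟨1, h1p⟩)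

end center

/-! ### The Poisson bracket induced on the center of the reduction -/

section universal
variable (R : Type u) [CommRing R] (p : ℕ)

theorem rep_y_pow (n : ℕ) (m : R[X][X]) :
    rep R (y R ^ n) m = ∑ k ∈ Finset.range (n + 1),
      C X ^ (n - k) * (derivative^[k] m) * (n.choose k : R[X][X]) := by
  have hc : Commute (derivative (R := R[X])) (LinearMap.mulLeft R[X] (C X : R[X][X])) := by
    refine LinearMap.ext fun m => ?_
    simp [derivative_mul]
  have h : ∀ n (m : R[X][X]), rep R (y R ^ n) m =
      ((derivative (R := R[X]) + LinearMap.mulLeft R[X] (C X : R[X][X])) ^ n) m := by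
    intro n
    induction n with
    | zero => intro m; simp
    | succ n ih =>
      intro m
      rw [pow_succ, pow_succ, map_mul, Module.End.mul_apply, Module.End.mul_apply, ih, rep_y]
      simp [add_comm]
  rw [h, hc.add_pow, LinearMap.sum_apply]
  refine Finset.sum_congr rfl fun k _ => ?_
  rw [(hc.pow_pow k (n - k)).eq, Module.End.mul_apply, Module.End.mul_apply,
    LinearMap.pow_mulLeft, Module.End.natCast_apply, map_nsmul, map_nsmul, nsmul_eq_mul, mul_comm,
    LinearMap.mulLeft_apply, Module.End.pow_apply]

variable {R} in
theorem symb_natCast_mul (n : ℕ) (a : W R) : symb ((n : W R) * a) = C (C (n : R)) * symb a := by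
  rw [← nsmul_eq_mul, map_nsmul, nsmul_eq_mul]; simp

/-- Normal ordering gives the sum over k ≥ 1 of k! C(p,k)² x^(p-k) y^(p-k). For k < p both k! C(p,k)
and C(p,k) are divisible by p, and k = p contributes p!. -/
theorem commutator_pow_prime (hp : p.Prime) : ∃ w : W R,
    y R ^ p * x R ^ p - x R ^ p * y R ^ p = (p : W R) * (((p - 1).factorial : ℕ) + p * w) := by
  obtain ⟨q, rfl⟩ : ∃ q, p = q + 1 := ⟨p - 1, (Nat.succ_pred_prime hp).symm⟩
  have h1 : symb (y R ^ (q + 1) * x R ^ (q + 1) - x R ^ (q + 1) * y R ^ (q + 1)) =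
      (∑ k ∈ Finset.range q, (C X : R[X][X]) ^ (q + 1 - (k + 1)) *
        (derivative^[k + 1] (X ^ (q + 1))) * ((q + 1).choose (k + 1) : R[X][X])) +
        ((q + 1).factorial : R[X][X]) := by
    have hx : symb (x R ^ (q + 1)) = X ^ (q + 1) := by
      rw [← mul_one (x R ^ (q + 1)), symb_x_pow_mul, symb_one, mul_one]
    have hy : symb (y R ^ (q + 1)) = C X ^ (q + 1) := by
      have := symb_aeval_y (R := R) (X ^ (q + 1))
      rwa [map_pow (aeval (y R)), aeval_X, C_pow] at this
    rw [map_sub, symb_x_pow_mul, hy, symb_mul, hx, rep_y_pow, Finset.sum_range_succ,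
      Finset.sum_range_succ', iterate_derivative_X_pow_eq_natCast_mul (q + 1) (q + 1),
      Nat.descFactorial_self]
    simp only [Nat.sub_zero, Function.iterate_zero, id_eq, Nat.choose_zero_right, Nat.sub_self,
      Nat.choose_self, pow_zero, Nat.cast_one, mul_one, one_mul]
    ring
  have h2 : ((q + 1 : ℕ) : R[X][X]) * ((q + 1 : ℕ) : R[X][X]) ∣
      ∑ k ∈ Finset.range q, (C X : R[X][X]) ^ (q + 1 - (k + 1)) *
        (derivative^[k + 1] (X ^ (q + 1))) * ((q + 1).choose (k + 1) : R[X][X]) := by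
    refine Finset.dvd_sum fun k hk => ?_
    have hk' := Finset.mem_range.1 hk
    rw [iterate_derivative_X_pow_eq_natCast_mul]
    refine mul_dvd_mul (Dvd.dvd.mul_left (Dvd.dvd.mul_right ?_ _) _) ?_
    · exact Nat.cast_dvd_cast (by rw [Nat.succ_descFactorial_succ]; exact dvd_mul_right _ _)
    · exact Nat.cast_dvd_cast (hp.dvd_choose_self (by omega) (by omega))
  obtain ⟨m, hm⟩ := h2
  refine ⟨ofPoly R m, symb_injective ?_⟩
  have h3 : symb (((q.factorial : ℕ) : W R)) = (q.factorial : R[X][X]) := by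
    rw [← mul_one ((q.factorial : ℕ) : W R), symb_natCast_mul, symb_one]; simp
  rw [h1, hm, symb_natCast_mul, map_add, symb_natCast_mul, symb_ofPoly, Nat.add_sub_cancel, h3,
    Nat.factorial_succ]
  simp only [Nat.cast_mul, map_natCast]
  ring

end universal

section bracket
variable {R : Type u} [CommRing R] {B : Type u} [CommRing B] (p : ℕ) (g : R →+* B)

theorem map_surjective (hg : Function.Surjective g) : Function.Surjective (map g) := fun a => by
  obtain ⟨m, hm⟩ := Polynomial.map_surjective (mapRingHom g) (Polynomial.map_surjective g hg)
    (symb a)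
  refine ⟨ofPoly R m, ?_⟩
  rw [map_ofPoly, hm, ofPoly_symb]

theorem exists_eq_mul_of_map_eq_zero (hk : ∀ r, g r = 0 → (p : R) ∣ r) {a : W R}
    (ha : map g a = 0) : ∃ b, a = p * b := by
  have h : C (C (p : R)) ∣ symb a := by
    rw [C_dvd_iff_dvd_coeff]
    intro i
    rw [C_dvd_iff_dvd_coeff]
    intro j
    refine hk _ ?_
    have h1 := congrArg (fun m => (m.coeff i).coeff j) (symb_map g a)
    simpa [ha] using h1.symm
  obtain ⟨m, hm⟩ := h
  refine ⟨ofPoly R m, symb_injective ?_⟩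
  rw [symb_natCast_mul, symb_ofPoly, hm]

theorem natCast_mul_cancel (h0 : ∀ r : R, (p : R) * r = 0 → r = 0) {a b : W R}
    (h : (p : W R) * a = p * b) : a = b := by
  refine symb_injective ?_
  have h1 := congrArg symb h
  rw [symb_natCast_mul, symb_natCast_mul] at h1
  ext i j
  have h2 := congrArg (fun m => (m.coeff i).coeff j) h1
  simp only [coeff_C_mul] at h2
  exact sub_eq_zero.1 (h0 _ (by rw [mul_sub, h2, sub_self]))

/-- The commutator of `a` and `b` is `p` times a lift of `w`. -/
def Br (a b : W R) (w : W B) : Prop := ∃ v, a * b - b * a = p * v ∧ map g v = w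

variable {p g}

theorem Br.unique (h0 : ∀ r : R, (p : R) * r = 0 → r = 0) {a b : W R} {w w' : W B}
    (h : Br p g a b w) (h' : Br p g a b w') : w = w' := by
  obtain ⟨v, h1, rfl⟩ := h
  obtain ⟨v', h2, rfl⟩ := h'
  rw [natCast_mul_cancel p h0 (h1.symm.trans h2)]

theorem Br.symm {a b : W R} {w : W B} (h : Br p g a b w) : Br p g b a (-w) := by
  obtain ⟨v, h1, rfl⟩ := h
  exact ⟨-v, by rw [mul_neg, ← h1, neg_sub], map_neg _ _⟩

theorem Br.add {a a' b : W R} {w w' : W B} (h : Br p g a b w) (h' : Br p g a' b w') :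
    Br p g (a + a') b (w + w') := by
  obtain ⟨v, h1, rfl⟩ := h
  obtain ⟨v', h2, rfl⟩ := h'
  exact ⟨v + v', by rw [mul_add (p : W R), ← h1, ← h2]; noncomm_ring, map_add _ _ _⟩

theorem Br.mul {a a' b : W R} {w w' : W B} (h : Br p g a b w) (h' : Br p g a' b w') :
    Br p g (a * a') b (map g a * w' + w * map g a') := by
  obtain ⟨v, h1, rfl⟩ := h
  obtain ⟨v', h2, rfl⟩ := h'
  refine ⟨a * v' + v * a', ?_, by simp⟩
  rw [mul_add (p : W R), ← mul_assoc (p : W R), (Nat.cast_commute p a).eq, mul_assoc a (p : W R),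
    ← h2, ← mul_assoc (p : W R), ← h1]
  noncomm_ring

theorem Br.algebraMap (r : R) (b : W R) : Br p g (algebraMap R _ r) b 0 :=
  ⟨0, by rw [Algebra.commutes, sub_self, mul_zero], map_zero _⟩

theorem Br.self (a : W R) : Br p g a a 0 := ⟨0, by rw [sub_self, mul_zero], map_zero _⟩

/-- The commutator divided by `p` is the commutator of `a` and `b`, which vanishes after reduction
because `b` becomes central. -/
theorem Br.natCast_mul {a b : W R} (hb : ∀ w, Commute w (map g b)) : Br p g (p * a) b 0 := by
  refine ⟨a * b - b * a, ?_, ?_⟩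
  · rw [mul_sub, mul_assoc, ← mul_assoc b, ← (Nat.cast_commute p b).eq, mul_assoc]
  · rw [map_sub, map_mul, map_mul, (hb (map g a)).eq, sub_self]

variable (B) in
/-- The partial derivative in the inner variable. -/
def innerDerivative : B[X][X] →ₗ[B] B[X][X] :=
  lsum fun i => (monomial i).restrictScalars B ∘ₗ derivative

theorem innerDerivative_monomial (i : ℕ) (f : B[X]) :
    innerDerivative B (monomial i f) = monomial i (derivative f) := by
  simp [innerDerivative, lsum_apply]

theorem coeff_innerDerivative (F : B[X][X]) (i : ℕ) :
    (innerDerivative B F).coeff i = derivative (F.coeff i) := by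
  induction F using Polynomial.induction_on' with
  | add p q hp hq => simp [hp, hq]
  | monomial k f =>
    rw [innerDerivative_monomial, coeff_monomial, coeff_monomial]
    split_ifs <;> simp

/-- The Poisson bracket of two bivariate polynomials. -/
def poisson (F G : B[X][X]) : B[X][X] :=
  innerDerivative B F * derivative G - derivative F * innerDerivative B G

variable [hp : Fact p.Prime] [CharP B p]

variable (p) in
/-- A lift of a polynomial in the `p`-th powers of the generators. -/
def frobLift (F : R[X][X]) : W R := ofPoly R (expand₂ p R F)

theorem frobLift_monomial (i : ℕ) (f : R[X]) :
    frobLift p (monomial i f) = (x R ^ p) ^ i * aeval (y R ^ p) f := by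
  rw [frobLift, ← C_mul_X_pow_eq_monomial]
  simp only [expand₂, RingHom.comp_apply, map_mul, map_pow, coe_mapRingHom, map_C, map_X,
    AlgHom.toRingHom_eq_coe, RingHom.coe_coe, expand_X, expand_C]
  rw [← pow_mul, C_mul_X_pow_eq_monomial, ofPoly_monomial, pow_mul, expand_aeval]

theorem frobLift_add (F G : R[X][X]) : frobLift p (F + G) = frobLift p F + frobLift p G := by
  simp [frobLift]

theorem map_frobLift (F : R[X][X]) :
    map g (frobLift p F) = frob p B (F.map (mapRingHom g)) := by
  refine symb_injective ?_
  rw [symb_frob, frobLift, map_ofPoly, symb_ofPoly]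
  induction F using Polynomial.induction_on' with
  | add p q hp hq => simp only [map_add, Polynomial.map_add, hp, hq]
  | monomial i f =>
    rw [← C_mul_X_pow_eq_monomial]
    simp only [expand₂, RingHom.comp_apply, map_mul, map_pow, coe_mapRingHom, map_C, map_X,
      AlgHom.toRingHom_eq_coe, RingHom.coe_coe, expand_X, expand_C, Polynomial.map_mul,
      Polynomial.map_pow, map_expand]

/-- The bracket with `b` is a derivation, so it is determined by its values on x^p and y^p through
the chain rule. -/
theorem frobLift_Br {b : W R} {w₁ w₂ : W B} (h₁ : Br p g (x R ^ p) b w₁)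
    (h₂ : Br p g (y R ^ p) b w₂) (F : R[X][X]) :
    Br p g (frobLift p F) b
      (frob p B (derivative (F.map (mapRingHom g))) * w₁ +
        frob p B (innerDerivative B (F.map (mapRingHom g))) * w₂) := by
  have mx : ∀ i, map g ((x R ^ p) ^ i) = frob p B (X ^ i) := fun i => by
    rw [map_pow (map g), map_pow (map g), map_x, map_pow (frob p B), frob_X]
  have my : ∀ f : R[X], map g (aeval (y R ^ p) f) = frob p B (C (f.map g)) := fun f => by
    have := map_frobLift (p := p) (g := g) (C f)
    rwa [← monomial_zero_left, frobLift_monomial, pow_zero, one_mul, monomial_zero_left,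
      Polynomial.map_C] at this
  have hx : ∀ i, Br p g ((x R ^ p) ^ i) b (frob p B (derivative (X ^ i)) * w₁) := by
    intro i
    induction i with
    | zero => simpa using Br.algebraMap (p := p) (g := g) (1 : R) b
    | succ i ih =>
      have h := ih.mul h₁
      rw [pow_succ]
      convert h using 1
      rw [← pow_one (x R ^ p), ← pow_mul (x R ^ p), one_mul, mx, mx, pow_one, pow_succ,
        derivative_mul, derivative_X, mul_one, map_add (frob p B), map_mul (frob p B),
        mul_assoc _ w₁, ← (frob_commute p B X w₁).eq]
      noncomm_ring
  have hy : ∀ f : R[X], Br p g (aeval (y R ^ p) f) b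
      (frob p B (C (derivative (f.map g))) * w₂) := by
    intro f
    induction f using Polynomial.induction_on with
    | C r => simpa using Br.algebraMap (p := p) (g := g) r b
    | add f₁ f₂ hf₁ hf₂ =>
      rw [map_add]
      convert hf₁.add hf₂ using 1
      rw [Polynomial.map_add, derivative_add, C_add, map_add, add_mul]
    | monomial n r ih =>
      have h := ih.mul h₂
      rw [pow_succ, ← mul_assoc, map_mul _ _ X, aeval_X]
      convert h using 1
      have hX := my X
      rw [aeval_X, map_X] at hX
      rw [my, hX, Polynomial.map_mul, map_X, derivative_mul, derivative_X, mul_one, C_add, C_mul,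
        map_add (frob p B), map_mul (frob p B), mul_assoc _ w₂, ← (frob_commute p B _ w₂).eq]
      noncomm_ring
  induction F using Polynomial.induction_on' with
  | add F G hF hG =>
    rw [frobLift_add]
    convert hF.add hG using 1
    simp only [Polynomial.map_add, map_add]
    noncomm_ring
  | monomial i f =>
    rw [frobLift_monomial]
    convert (hx i).mul (hy f) using 1
    have e1 : (monomial i f).map (mapRingHom g) = X ^ i * C (f.map g) := by
      rw [map_monomial, ← C_mul_X_pow_eq_monomial, mul_comm]; rfl
    have e2 : innerDerivative B (X ^ i * C (f.map g)) = X ^ i * C (derivative (f.map g)) := by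
      rw [mul_comm, C_mul_X_pow_eq_monomial, innerDerivative_monomial, ← C_mul_X_pow_eq_monomial,
        mul_comm]
    rw [e1, e2, mx, my, derivative_mul, derivative_C, mul_zero, add_zero, map_mul (frob p B),
      map_mul (frob p B), mul_assoc _ w₁, ← (frob_commute p B _ w₁).eq]
    noncomm_ring

/-- The identity of `commutator_pow_prime` is specialised along (x, y) ↦ (S, T); the value -1 is
Wilson's theorem. -/
theorem pair_Br {S T : W R} (h : T * S = S * T + 1) : Br p g (T ^ p) (S ^ p) (-1) := by
  obtain ⟨w, hw⟩ := commutator_pow_prime R p hp.out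
  have h1 := congrArg (lift S T h) hw
  simp only [map_sub, map_mul, map_pow, lift_x, lift_y, map_add, map_natCast] at h1
  refine ⟨_, h1, ?_⟩
  have h2 : ((p - 1).factorial : W B) = -1 := by
    have h3 := congrArg (fun z => algebraMap B (W B) (ZMod.castHom (dvd_refl p) B z))
      (ZMod.wilsons_lemma p)
    simpa only [map_natCast, map_neg, map_one] using h3
  rw [map_add (map g), map_mul (map g), map_natCast, map_natCast, natCast_prime_eq_zero p B, h2,
    zero_mul, add_zero]

/-- The homomorphism induced on centers preserves the Poisson bracket. -/
theorem poisson_eq_one (h0 : ∀ r : R, (p : R) * r = 0 → r = 0) (hg : Function.Surjective g)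
    (hk : ∀ r, g r = 0 → (p : R) ∣ r) {S T : W R} (h : T * S = S * T + 1) {P Q : B[X][X]}
    (hP : frob p B P = map g S ^ p) (hQ : frob p B Q = map g T ^ p) :
    poisson Q P = 1 := by
  have hlift : ∀ (F : B[X][X]) (a : W R), frob p B F = map g a → ∃ G : R[X][X],
      G.map (mapRingHom g) = F ∧ ∃ b, a = p * b + frobLift p G := by
    intro F a ha
    obtain ⟨G, hG⟩ := Polynomial.map_surjective (mapRingHom g) (Polynomial.map_surjective g hg) F
    obtain ⟨b, hb⟩ := exists_eq_mul_of_map_eq_zero p g hk (a := a - frobLift p G)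
      (by rw [map_sub, map_frobLift, hG, ha, sub_self])
    exact ⟨G, hG, b, by rw [← hb, sub_add_cancel]⟩
  obtain ⟨P', rfl, S', hS'⟩ := hlift P (S ^ p) (by rw [hP, map_pow])
  obtain ⟨Q', rfl, T', hT'⟩ := hlift Q (T ^ p) (by rw [hQ, map_pow])
  have hyx : Br p g (y R ^ p) (x R ^ p) (-1) := pair_Br (y_mul_x R)
  -- The chain rule is applied in one argument at a time: x^p and y^p against `P'`, then `Q'`
  -- against `P'`.
  have h1 := (frobLift_Br (Br.self (x R ^ p)) hyx P').symm
  have h2 := (frobLift_Br hyx.symm (Br.self (y R ^ p)) P').symm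
  have h3 := frobLift_Br h1 h2 Q'
  have hcP : ∀ w, Commute w (map g (frobLift p P')) := fun w => by
    rw [map_frobLift]; exact (frob_commute p B _ _).symm
  have hcT : ∀ w, Commute w (map g (T ^ p)) := fun w => by
    rw [map_pow, ← hQ]; exact (frob_commute p B _ _).symm
  -- The corrections `p * T'` and `p * S'` contribute nothing, since the other argument is central
  -- modulo `p`.
  have h4 := (Br.natCast_mul (p := p) (g := g) (a := T') hcP).add h3
  rw [← hT'] at h4
  have h5 := ((Br.natCast_mul (p := p) (g := g) (a := S') hcT).add h4.symm).symm
  rw [← hS'] at h5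
  have h6 := h5.unique h0 (pair_Br h)
  refine frob_injective p B ?_
  rw [map_one, poisson, map_sub, map_mul, map_mul]
  rw [← neg_inj, ← h6]
  noncomm_ring

end bracket

/-! ### Keller maps whose second component vanishes on an axis -/

section keller
variable {k : Type u} [Field k] {p : ℕ} [hp : Fact p.Prime] [CharP k p] {P Q : k[X][X]}

theorem coeff_coeff_mul (F G : k[X][X]) (a b : ℕ) :
    ((F * G).coeff a).coeff b = ∑ s ∈ Finset.HasAntidiagonal.antidiagonal a ×ˢ Finset.HasAntidiagonal.antidiagonal b,
      (F.coeff s.1.1).coeff s.2.1 * (G.coeff s.1.2).coeff s.2.2 := by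
  rw [coeff_mul, finsetSum_coeff, Finset.sum_product]
  exact Finset.sum_congr rfl fun s _ => coeff_mul _ _ _

theorem coeff_X_mul_derivative {C : Type v} [CommRing C] (f : C[X]) (i : ℕ) :
    (X * derivative f).coeff i = i * f.coeff i := by
  rcases i with _ | i
  · simp
  · rw [coeff_X_mul, coeff_derivative]; push_cast; ring

/-- Multiplying the bracket by xy turns the partial derivatives into Euler operators, which weight
each coefficient by its exponent. -/
theorem poisson_coeff (h : poisson Q P = 1) (a b : ℕ) :
    ∑ s ∈ Finset.HasAntidiagonal.antidiagonal a ×ˢ Finset.HasAntidiagonal.antidiagonal b,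
      ((s.2.1 * s.1.2 - s.1.1 * s.2.2 : ℤ) : k) *
        ((Q.coeff s.1.1).coeff s.2.1 * (P.coeff s.1.2).coeff s.2.2) =
      if a = 1 ∧ b = 1 then 1 else 0 := by
  have h1 : (C X * innerDerivative k Q) * (X * derivative P) -
      (X * derivative Q) * (C X * innerDerivative k P) = X * C X := by
    have : X * C X * poisson Q P = X * C X := by rw [h, mul_one]
    rw [← this, poisson]; ring
  have h2 := congrArg (fun F => (F.coeff a).coeff b) h1
  have h3 : ((X * C X : k[X][X]).coeff a).coeff b = if a = 1 ∧ b = 1 then 1 else 0 := by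
    rw [coeff_mul_C, coeff_X]
    by_cases ha : a = 1 <;> by_cases hb : b = 1 <;> simp [ha, hb, coeff_X, eq_comm]
  have hy : ∀ (F : k[X][X]) i j, ((C X * innerDerivative k F).coeff i).coeff j =
      j * (F.coeff i).coeff j := fun F i j => by
    rw [coeff_C_mul, coeff_innerDerivative, coeff_X_mul_derivative]
  have hx : ∀ (F : k[X][X]) i j, ((X * derivative F).coeff i).coeff j =
      i * (F.coeff i).coeff j := fun F i j => by
    rw [coeff_X_mul_derivative, ← C_eq_natCast, coeff_C_mul]
  simp only [coeff_sub, coeff_coeff_mul, hx, hy, h3, ← Finset.sum_sub_distrib] at h2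
  rw [← h2]
  refine Finset.sum_congr rfl fun s _ => ?_
  push_cast
  ring

/-- The restriction to the axis of a Keller map whose second component vanishes there. -/
theorem keller_axis (h : poisson Q P = 1)
    (hQ : ∀ i, (Q.coeff i).coeff 0 = 0) {D : ℕ} (hD : 2 * D < p)
    (hPD : ∀ i j, (P.coeff i).coeff j ≠ 0 → i ≤ D ∧ j ≤ D) :
    ((P.coeff 1).coeff 0 ≠ 0 ∧ ∀ i, 2 ≤ i → (P.coeff i).coeff 0 = 0) ∧
      ((Q.coeff 0).coeff 1 ≠ 0 ∧ ∀ i, 1 ≤ i → (Q.coeff i).coeff 1 = 0) := by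
  -- On the axis y = 0 the x-derivative of `Q` vanishes, so Q_y · P_x = 1 in k[x] and both factors
  -- are constants.
  have h1 := congrArg (mapRingHom (constantCoeff (R := k))) h
  rw [poisson, map_sub, map_mul, map_mul, map_one] at h1
  have h2 : mapRingHom (constantCoeff (R := k)) (derivative Q) = 0 := by
    ext i
    rw [coe_mapRingHom, coeff_map, coeff_derivative, map_mul, constantCoeff_apply,
      hQ, zero_mul, coeff_zero]
  rw [h2, zero_mul, sub_zero, coe_mapRingHom] at h1
  have hq : ∀ i, ((innerDerivative k Q).map constantCoeff).coeff i = (Q.coeff i).coeff 1 := by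
    intro i
    rw [coeff_map, coeff_innerDerivative, constantCoeff_apply, coeff_derivative]; simp
  have hr : ∀ i, ((derivative P).map constantCoeff).coeff i =
      (P.coeff (i + 1)).coeff 0 * (i + 1 : ℕ) := by
    intro i
    rw [coeff_map, coeff_derivative, map_mul, constantCoeff_apply]; simp
  have hdeg := congrArg natDegree h1
  have hne1 : (innerDerivative k Q).map constantCoeff ≠ 0 := left_ne_zero_of_mul_eq_one h1
  have hne2 : (derivative P).map constantCoeff ≠ 0 := right_ne_zero_of_mul_eq_one h1
  rw [natDegree_mul hne1 hne2, natDegree_one] at hdeg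
  have h0 := congrArg (fun f => f.coeff 0) h1
  simp only [mul_coeff_zero, hq, hr, coeff_one_zero] at h0
  refine ⟨⟨fun hh => by simp [hh] at h0, fun i hi => ?_⟩, fun hh => by simp [hh] at h0, fun i hi => ?_⟩
  · by_contra hc
    obtain ⟨i, rfl⟩ : ∃ i', i = i' + 1 := ⟨i - 1, by omega⟩
    have h3 := hr i
    rw [coeff_eq_zero_of_natDegree_lt (by omega)] at h3
    have h4 := (mul_eq_zero.1 h3.symm).resolve_left hc
    rw [CharP.cast_eq_zero_iff k p] at h4
    have := Nat.le_of_dvd (by omega) h4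
    have := (hPD _ _ hc).1
    omega
  · rw [← hq, coeff_eq_zero_of_natDegree_lt (by omega)]

/-- A Keller map of small degree whose second component vanishes on an axis is triangular:
otherwise the vertices of the two Newton polygons in the direction of the steepest edge would
contribute a nonzero term to the Poisson bracket. -/
theorem keller_triangular (h : poisson Q P = 1)
    (hQ : ∀ i, (Q.coeff i).coeff 0 = 0) {D : ℕ} (hD : 2 * D < p)
    (hPD : ∀ i j, (P.coeff i).coeff j ≠ 0 → i ≤ D ∧ j ≤ D)
    (hQD : ∀ i j, (Q.coeff i).coeff j ≠ 0 → i ≤ D ∧ j ≤ D) :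
    (∀ i j, (P.coeff i).coeff j ≠ 0 → i ≤ 1) ∧ (∀ i j, (Q.coeff i).coeff j ≠ 0 → i = 0) := by
  classical
  obtain ⟨⟨hP1, hP2⟩, hQ1, hQ2⟩ := keller_axis h hQ hD hPD
  let box := Finset.range (D + 1) ×ˢ Finset.range (D + 1)
  -- The supports are translated so that the term x of `P` and the term y of `Q` sit at the origin;
  -- the claim is that no point has positive first coordinate.
  let SP : Finset (ℤ × ℤ) := (box.filter fun s => (P.coeff s.1).coeff s.2 ≠ 0).image
    fun s => ((s.1 : ℤ) - 1, (s.2 : ℤ))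
  let SQ : Finset (ℤ × ℤ) := (box.filter fun s => (Q.coeff s.1).coeff s.2 ≠ 0).image
    fun s => ((s.1 : ℤ), (s.2 : ℤ) - 1)
  have memP : ∀ i j, (P.coeff i).coeff j ≠ 0 → ((i : ℤ) - 1, (j : ℤ)) ∈ SP := fun i j hij => by
    have := hPD i j hij
    refine Finset.mem_image.2 ⟨(i, j), Finset.mem_filter.2 ⟨?_, hij⟩, rfl⟩
    simp only [box, Finset.mem_product, Finset.mem_range]; omega
  have memQ : ∀ i j, (Q.coeff i).coeff j ≠ 0 → ((i : ℤ), (j : ℤ) - 1) ∈ SQ := fun i j hij => by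
    have := hQD i j hij
    refine Finset.mem_image.2 ⟨(i, j), Finset.mem_filter.2 ⟨?_, hij⟩, rfl⟩
    simp only [box, Finset.mem_product, Finset.mem_range]; omega
  have ofP : ∀ s ∈ SP, ∃ i j : ℕ, (P.coeff i).coeff j ≠ 0 ∧ s = ((i : ℤ) - 1, (j : ℤ)) :=
    fun s hs => by
      obtain ⟨⟨i, j⟩, h1, rfl⟩ := Finset.mem_image.1 hs
      exact ⟨i, j, (Finset.mem_filter.1 h1).2, rfl⟩
  have ofQ : ∀ s ∈ SQ, ∃ i j : ℕ, (Q.coeff i).coeff j ≠ 0 ∧ s = ((i : ℤ), (j : ℤ) - 1) :=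
    fun s hs => by
      obtain ⟨⟨i, j⟩, h1, rfl⟩ := Finset.mem_image.1 hs
      exact ⟨i, j, (Finset.mem_filter.1 h1).2, rfl⟩
  have hQj : ∀ i j, (Q.coeff i).coeff j ≠ 0 → 1 ≤ j := fun i j hij => by
    rcases j with _ | j
    · exact absurd (hQ i) hij
    · omega
  -- By `keller_axis`, a point right of the origin lies strictly above the axis, so the quotient
  -- maximised below has a positive denominator.
  have hpos : ∀ s ∈ SP ∪ SQ, 0 ≤ s.2 ∧ (0 < s.1 → 0 < s.2) := by
    intro s hs
    rcases Finset.mem_union.1 hs with hs | hs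
    · obtain ⟨i, j, hij, rfl⟩ := ofP s hs
      refine ⟨by simp, fun h1 => ?_⟩
      rcases j with _ | j
      · exact absurd (hP2 i (by simp at h1; omega)) hij
      · simp
    · obtain ⟨i, j, hij, rfl⟩ := ofQ s hs
      have := hQj i j hij
      refine ⟨by simp; omega, fun h1 => ?_⟩
      rcases this.eq_or_lt with rfl | h2
      · exact absurd (hQ2 i (by simp at h1; omega)) hij
      · simp; omega
  by_contra hcon
  have hne : ((SP ∪ SQ).filter fun s => 0 < s.1).Nonempty := by
    by_contra hemp
    rw [Finset.not_nonempty_iff_eq_empty, Finset.filter_eq_empty_iff] at hemp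
    refine hcon ⟨fun i j hij => ?_, fun i j hij => ?_⟩
    · have := hemp (Finset.mem_union_left _ (memP i j hij))
      simp at this; omega
    · have := hemp (Finset.mem_union_right _ (memQ i j hij))
      simp at this; omega
  obtain ⟨⟨r₀, q₀⟩, hm, hmax⟩ :=
    Finset.exists_max_image _ (fun s : ℤ × ℤ => (s.1 : ℚ) / s.2) hne
  obtain ⟨hm, hr₀⟩ := Finset.mem_filter.1 hm
  have hq₀ : 0 < q₀ := (hpos _ hm).2 hr₀
  simp only at hr₀
  have hle : ∀ s ∈ SP ∪ SQ, q₀ * s.1 ≤ r₀ * s.2 := by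
    intro s hs
    obtain ⟨h1, h2⟩ := hpos s hs
    by_cases h3 : 0 < s.1
    · have h4 := hmax s (Finset.mem_filter.2 ⟨hs, h3⟩)
      rw [div_le_div_iff₀ (by exact_mod_cast h2 h3) (by exact_mod_cast hq₀)] at h4
      have h5 : s.1 * q₀ ≤ r₀ * s.2 := by exact_mod_cast h4
      linarith
    · nlinarith
  have h00P : ((0, 0) : ℤ × ℤ) ∈ SP := by simpa using memP 1 0 hP1
  have h00Q : ((0, 0) : ℤ × ℤ) ∈ SQ := by simpa using memQ 0 1 hQ1
  -- `u` and `w` are the topmost points of the two supports on the boundary line; the origin shows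
  -- that such points exist.
  obtain ⟨u, hu, humax⟩ := Finset.exists_max_image (SP.filter fun s => q₀ * s.1 = r₀ * s.2)
    (fun s => s.2) ⟨(0, 0), Finset.mem_filter.2 ⟨h00P, by simp⟩⟩
  obtain ⟨w, hw, hwmax⟩ := Finset.exists_max_image (SQ.filter fun s => q₀ * s.1 = r₀ * s.2)
    (fun s => s.2) ⟨(0, 0), Finset.mem_filter.2 ⟨h00Q, by simp⟩⟩
  obtain ⟨hu, hue⟩ := Finset.mem_filter.1 hu
  obtain ⟨hw, hwe⟩ := Finset.mem_filter.1 hw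
  have hupos := (hpos u (Finset.mem_union_left _ hu)).1
  have hwpos := (hpos w (Finset.mem_union_right _ hw)).1
  have hsum : 0 < u.2 + w.2 := by
    rcases Finset.mem_union.1 hm with hm | hm
    · have := humax (r₀, q₀) (Finset.mem_filter.2 ⟨hm, mul_comm _ _⟩)
      simp only at this; omega
    · have := hwmax (r₀, q₀) (Finset.mem_filter.2 ⟨hm, mul_comm _ _⟩)
      simp only at this; omega
  obtain ⟨iu, ju, hPu, rfl⟩ := ofP u hu
  obtain ⟨iw, jw, hQw, rfl⟩ := ofQ w hw
  simp only at hue hwe hupos hwpos hsum humax hwmax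
  have hcoef := poisson_coeff h (iw + iu) (jw + ju)
  rw [if_neg (by omega), Finset.sum_eq_single ((iw, iu), (jw, ju))] at hcoef
  -- Since `u` and `w` are parallel, the determinant of the exponents collapses to `jw + iu - 1`,
  -- which lies between 1 and 2D - 1 and so is nonzero modulo `p`.
  · have hdet : ((jw : ℤ) * iu - iw * ju) = jw + iu - 1 := by
      have h1 : q₀ * (((jw : ℤ) - 1) * (iu - 1) - iw * ju) = 0 := by
        linear_combination ((jw : ℤ) - 1) * hue - (ju : ℤ) * hwe
      have h2 := (mul_eq_zero.1 h1).resolve_left hq₀.ne'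
      linarith
    have hiu : (0 : ℤ) ≤ (iu : ℤ) - 1 := by
      by_contra hc
      have : q₀ * ((iu : ℤ) - 1) < 0 := mul_neg_of_pos_of_neg hq₀ (by omega)
      have : 0 ≤ r₀ * (ju : ℤ) := by positivity
      omega
    simp only [hdet] at hcoef
    have h3 := (mul_eq_zero.1 hcoef).resolve_right (mul_ne_zero hQw hPu)
    rw [CharP.intCast_eq_zero_iff k p] at h3
    have h4 := Int.le_of_dvd (by omega) h3
    have := (hPD _ _ hPu).1
    have := (hQD _ _ hQw).2
    omega
  -- A competing pair with the same exponent sum must lie on the boundary line; as `u` and `w` are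
  -- topmost there, it coincides with them.
  · rintro ⟨⟨i, i'⟩, ⟨j, j'⟩⟩ hmem hneq
    simp only [Finset.mem_product, Finset.HasAntidiagonal.mem_antidiagonal] at hmem
    by_contra hnz
    have hPQ := right_ne_zero_of_mul hnz
    have hq := left_ne_zero_of_mul hPQ
    have hp' := right_ne_zero_of_mul hPQ
    simp only at hq hp'
    have m1 := memP i' j' hp'
    have m2 := memQ i j hq
    have l1 := hle _ (Finset.mem_union_left _ m1)
    have l2 := hle _ (Finset.mem_union_right _ m2)
    simp only at l1 l2
    have e1 : (i : ℤ) + i' = iw + iu := by exact_mod_cast hmem.1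
    have e2 : (j : ℤ) + j' = jw + ju := by exact_mod_cast hmem.2
    have e3 : q₀ * ((i' : ℤ) - 1) + q₀ * i = r₀ * j' + r₀ * ((j : ℤ) - 1) := by
      linear_combination hue + hwe + q₀ * e1 - r₀ * e2
    have k1 := humax _ (Finset.mem_filter.2 ⟨m1, by simp only; linarith⟩)
    have k2 := hwmax _ (Finset.mem_filter.2 ⟨m2, by simp only; linarith⟩)
    simp only at k1 k2
    have e4 : j' = ju := by omega
    have e5 : j = jw := by omega
    subst e4 e5
    have e6 : q₀ * (i : ℤ) = q₀ * iw := by linarith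
    have e7 : (i : ℤ) = iw := mul_left_cancel₀ hq₀.ne' e6
    have e8 : i = iw := by exact_mod_cast e7
    have e9 : i' = iu := by omega
    exact hneq (by rw [e8, e9])
  · intro hn
    exact absurd (by simp [Finset.mem_product, Finset.HasAntidiagonal.mem_antidiagonal]) hn

end keller

/-! ### The standard involution and reduction modulo `p` -/

section bar
variable (R : Type u) [CommRing R]

open MulOpposite

/-- The anti-endomorphism fixing `x` and negating `y`. -/
def bar : W R →ₐ[R] (W R)ᵐᵒᵖ :=
  lift (op (x R)) (op (-y R)) (by
    rw [← op_mul, ← op_mul, ← op_one, ← op_add, neg_mul, mul_neg, y_mul_x]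
    congr 1
    abel)

theorem bar_x : bar R (x R) = op (x R) := by simp [bar]

theorem bar_y : bar R (y R) = op (-y R) := by simp [bar]

variable {R} {B : Type u} [CommRing B] (g : R →+* B)

theorem bar_map (a : W R) : bar B (map g a) = op (map g (unop (bar R a))) := by
  have h : ((bar B : W B →+* (W B)ᵐᵒᵖ).comp (map g)) = (map g).op.comp (bar R : W R →+* _) := by
    refine ringHom_ext (fun r => ?_) ?_ ?_
    · simp [RingHom.op, MulOpposite.algebraMap_apply]
    · simp [RingHom.op, bar_x]
    · simp [RingHom.op, bar_y]
  exact DFunLike.congr_fun h a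

variable {p : ℕ} [hp : Fact p.Prime] [CharP B p]

/-- As `p` is odd, y^p goes to -y^p; the reversal of products is harmless because the factors are
central. -/
theorem bar_frob (hp2 : p ≠ 2) (F : B[X][X]) :
    bar B (frob p B F) = op (frob p B (F.map (compRingHom (-X)))) := by
  have hodd : Odd p := hp.out.odd_of_ne_two hp2
  induction F using Polynomial.induction_on with
  | C f =>
    induction f using Polynomial.induction_on with
    | C r =>
      rw [frob_C_C, AlgHom.commutes, MulOpposite.algebraMap_apply, Polynomial.map_C,
        coe_compRingHom_apply, C_comp, frob_C_C]
    | add f g hf hg => simp only [map_add, Polynomial.map_add, hf, hg, op_add]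
    | monomial n r h =>
      rw [pow_succ, ← mul_assoc, C_mul, map_mul (frob p B), map_mul (bar B), h, frob_C_X,
        Polynomial.map_mul, map_mul (frob p B), map_pow (bar B), bar_y, ← op_pow, ← op_mul,
        hodd.neg_pow, Polynomial.map_C _ (a := X), coe_compRingHom_apply, X_comp, C_neg,
        map_neg (frob p B), frob_C_X, (frob_commute p B _ (-y B ^ p)).eq]
  | add f g hf hg => simp only [map_add, Polynomial.map_add, hf, hg, op_add]
  | monomial n r h =>
    have e : (C r * X ^ n * X).map (compRingHom (-X)) =
        (C r * X ^ n).map (compRingHom (-X)) * X := by rw [Polynomial.map_mul, map_X]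
    rw [pow_succ, ← mul_assoc, e, map_mul (frob p B), map_mul (bar B), h, frob_X,
      map_mul (frob p B), map_pow (bar B), bar_x, ← op_pow, ← op_mul, frob_X, ((Subalgebra.mem_center_iff.1 (x_pow_mem_center p B)) _)]

end bar

/-! ### Reduction of a skew Weyl pair to a residue field -/

section reduction
variable {R : Type u} [CommRing R] {k : Type u} [Field k] (p : ℕ) [hp : Fact p.Prime] [CharP k p]

theorem coeff_expand₂ (F : k[X][X]) (a b : ℕ) :
    ((expand₂ p k F).coeff (p * a)).coeff (p * b) = (F.coeff a).coeff b := by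
  have := coeff_expand₂_mul p k F hp.out.pos hp.out.pos hp.out.pos hp.out.pos a b
  simpa using this

theorem frob_eq_frobLift (B : Type u) [CommRing B] [CharP B p] (F : B[X][X]) :
    frob p B F = frobLift p F :=
  symb_injective (by rw [symb_frob, frobLift, symb_ofPoly])

theorem innerDerivative_map {B C : Type u} [CommRing B] [CommRing C] (g : B →+* C) (F : B[X][X]) :
    innerDerivative C (F.map (mapRingHom g)) = (innerDerivative B F).map (mapRingHom g) := by
  ext i : 1
  simp [coeff_innerDerivative, derivative_map]

theorem poisson_map {B C : Type u} [CommRing B] [CommRing C] (g : B →+* C) (F G : B[X][X]) :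
    poisson (F.map (mapRingHom g)) (G.map (mapRingHom g)) =
      (poisson F G).map (mapRingHom g) := by
  simp [poisson, innerDerivative_map, derivative_map]

theorem natDegree_map_symb_le {a : W R} {D : ℕ} (g : R →+* k) (ha : (symb a).natDegree ≤ D) :
    (symb (map g a)).natDegree ≤ D := by
  rw [symb_map]; exact natDegree_map_le.trans ha

theorem innerDegLE_map_symb {a : W R} {D : ℕ} (g : R →+* k) (ha : InnerDegLE (symb a) D) :
    InnerDegLE (symb (map g a)) D := fun i => by
  rw [symb_map, coeff_map, coe_mapRingHom]; exact natDegree_map_le.trans (ha i)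

theorem frob_degree_le {a : W k} {D : ℕ} (ha : (symb a).natDegree ≤ D)
    (ha' : InnerDegLE (symb a) D) {F : k[X][X]} (hF : frob p k F = a ^ p) (i j : ℕ)
    (hij : (F.coeff i).coeff j ≠ 0) : i ≤ D ∧ j ≤ D := by
  have h1 : symb (a ^ p) = expand₂ p k F := by rw [← hF, symb_frob]
  have h2 := (symb_pow_top a D p ha).1
  have h3 := ha'.symb_pow p
  rw [h1] at h2 h3
  rw [← coeff_expand₂ p] at hij
  constructor
  · by_contra hc
    rw [coeff_eq_zero_of_natDegree_lt (h2.trans_lt (Nat.mul_lt_mul_of_pos_left (by omega)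
      hp.out.pos)), coeff_zero] at hij
    exact hij rfl
  · by_contra hc
    exact hij (coeff_eq_zero_of_natDegree_lt ((h3 _).trans_lt
      (Nat.mul_lt_mul_of_pos_left (by omega) hp.out.pos)))

/-- Over a field the leading x-coefficient of a^p is the p-th power of that of `a`, hence nonzero,
so `F` has a coefficient in the x-degree of `a`. -/
theorem natDegree_symb_le_of_frob {a : W k} {F : k[X][X]} (hF : frob p k F = a ^ p) {d : ℕ}
    (hd : ∀ i j, (F.coeff i).coeff j ≠ 0 → i ≤ d) : (symb a).natDegree ≤ d := by
  by_contra hc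
  set n := (symb a).natDegree with hn
  have hn0 : (symb a).coeff n ≠ 0 := by
    rw [hn, coeff_natDegree]
    intro h0
    rw [leadingCoeff_eq_zero] at h0
    rw [hn, h0] at hc
    simp at hc
  have h1 := (symb_pow_top a n p le_rfl).2
  rw [← hF, symb_frob] at h1
  have h2 : (expand₂ p k F).coeff (p * n) = expand k p (F.coeff n) := by
    rw [mul_comm]
    exact (coeff_expand_mul hp.out.pos _ _).trans (coeff_map _ _)
  rw [h2] at h1
  have h3 : F.coeff n ≠ 0 := by
    intro h0
    rw [h0, map_zero] at h1
    exact pow_ne_zero p hn0 h1.symm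
  obtain ⟨j, hj⟩ : ∃ j, (F.coeff n).coeff j ≠ 0 := by
    by_contra hall
    push Not at hall
    exact h3 (ext hall)
  exact hc (hd n j hj)

variable {p}

/-- Reduction modulo `p` of a Weyl pair with skew second member. -/
theorem pair_reduction (hp2 : p ≠ 2) (h0 : ∀ r : R, (p : R) * r = 0 → r = 0) (g : R →+* k)
    {S T : W R} (h : T * S = S * T + 1) (hT : bar R T = MulOpposite.op (-T)) {D : ℕ}
    (hD : 2 * D < p) (hS1 : (symb S).natDegree ≤ D) (hS2 : InnerDegLE (symb S) D)
    (hT1 : (symb T).natDegree ≤ D) (hT2 : InnerDegLE (symb T) D) :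
    (symb (map g S)).natDegree ≤ 1 ∧ (symb (map g T)).natDegree ≤ 0 := by
  have hnu : (p : R) ∈ nonunits R := fun hu => by
    have := hu.map g
    rw [map_natCast, CharP.cast_eq_zero] at this
    exact not_isUnit_zero this
  have : CharP (R ⧸ Ideal.span {(p : R)}) p := CharP.quotient R p hnu
  -- Dividing commutators by `p` requires the kernel to be exactly (p), so the bracket is computed
  -- over R/(p), possibly not a domain, and then pushed to `k`.
  let q : R →+* R ⧸ Ideal.span {(p : R)} := Ideal.Quotient.mk _
  let g' : R ⧸ Ideal.span {(p : R)} →+* k := Ideal.Quotient.lift _ g fun r hr => by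
    obtain ⟨s, rfl⟩ := Ideal.mem_span_singleton.1 hr
    rw [map_mul, map_natCast, CharP.cast_eq_zero, zero_mul]
  have hgq : ∀ a, map g' (map q a) = map g a := fun a => by
    refine DFunLike.congr_fun (?_ : (map g').comp (map q) = map g) a
    exact ringHom_ext (fun r => by simp [g', q]) (by simp) (by simp)
  have hq : map q T * map q S = map q S * map q T + 1 := by
    rw [← map_mul, h, map_add, map_mul, map_one]
  obtain ⟨P, hP⟩ := exists_frob_of_mem_center p (pair_pow_mem_center p hq)
  obtain ⟨Q, hQ⟩ := exists_frob_of_mem_center p (z := map q T ^ p) (by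
    exact pair_pow_mem_center p (pair_neg_swap hq))
  have hPQ := poisson_eq_one (g := q) h0 Ideal.Quotient.mk_surjective
    (fun r hr => Ideal.mem_span_singleton.1 (Ideal.Quotient.eq_zero_iff_mem.1 hr)) h hP hQ
  have hPQ' := poisson_map g' Q P
  rw [hPQ, Polynomial.map_one] at hPQ'
  set P' := P.map (mapRingHom g')
  set Q' := Q.map (mapRingHom g')
  have hP' : frob p k P' = map g S ^ p := by
    rw [← hgq, ← map_pow, ← hP, frob_eq_frobLift p (R ⧸ _), map_frobLift]
  have hQ' : frob p k Q' = map g T ^ p := by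
    rw [← hgq, ← map_pow, ← hQ, frob_eq_frobLift p (R ⧸ _), map_frobLift]
  have hodd : Odd p := hp.out.odd_of_ne_two hp2
  -- T^p is skew, so `Q'` is odd in the inner variable; its constant coefficients satisfy 2q = 0
  -- with `p ≠ 2`.
  have hQ0 : ∀ i, (Q'.coeff i).coeff 0 = 0 := by
    intro i
    have h1 : bar k (map g T ^ p) = MulOpposite.op (-(map g T ^ p)) := by
      rw [map_pow, bar_map, hT, MulOpposite.unop_op, ← MulOpposite.op_pow, map_neg, hodd.neg_pow]
    rw [← hQ', bar_frob hp2, ← map_neg] at h1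
    have h2 := frob_injective p k (MulOpposite.op_injective h1)
    have h3 := congrArg (fun F => (F.coeff i).coeff 0) h2
    simp only [coeff_map, coe_compRingHom_apply, coeff_neg] at h3
    rw [coeff_zero_eq_eval_zero, eval_comp, eval_neg, eval_X, neg_zero,
      ← coeff_zero_eq_eval_zero, ← add_eq_zero_iff_eq_neg, ← two_mul] at h3
    refine (mul_eq_zero.1 h3).resolve_left fun h4 => ?_
    have h5 : ((2 : ℕ) : k) = 0 := by exact_mod_cast h4
    rw [CharP.cast_eq_zero_iff k p] at h5
    exact hp2 ((Nat.prime_dvd_prime_iff_eq hp.out Nat.prime_two).1 h5)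
  have hPd := frob_degree_le p (natDegree_map_symb_le g hS1) (innerDegLE_map_symb g hS2) hP'
  have hQd := frob_degree_le p (natDegree_map_symb_le g hT1) (innerDegLE_map_symb g hT2) hQ'
  obtain ⟨k1, k2⟩ := keller_triangular hPQ' hQ0 hD hPd hQd
  exact ⟨natDegree_symb_le_of_frob p hP' k1,
    natDegree_symb_le_of_frob p hQ' fun i j hij => (k2 i j hij).le⟩

end reduction

/-! ### Weyl pairs with a skew member in characteristic zero -/

section charZero
variable {K : Type u} [Field K]

theorem exists_innerDegLE (F : K[X][X]) : ∃ D, InnerDegLE F D :=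
  ⟨F.support.sup fun i => (F.coeff i).natDegree, fun i => by
    by_cases hi : i ∈ F.support
    · exact Finset.le_sup (f := fun i => (F.coeff i).natDegree) hi
    · rw [notMem_support_iff.1 hi, natDegree_zero]; exact Nat.zero_le _⟩

theorem map_injective {R B : Type u} [CommRing R] [CommRing B] {g : R →+* B}
    (hg : Function.Injective g) : Function.Injective (map g) := fun a b hab => by
  refine symb_injective (Polynomial.map_injective (mapRingHom g)
    (Polynomial.map_injective g hg) ?_)
  rw [← symb_map, hab, symb_map]

/-- The finite set of all coefficients of a bivariate polynomial. -/
def allCoeffs (F : K[X][X]) : Finset K :=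
  letI := Classical.decEq K
  F.support.biUnion fun i => (F.coeff i).coeffs

theorem mem_allCoeffs (F : K[X][X]) {i j : ℕ} (h : (F.coeff i).coeff j ≠ 0) :
    (F.coeff i).coeff j ∈ allCoeffs F := by
  classical
  unfold allCoeffs
  refine Finset.mem_biUnion.2 ⟨i, mem_support_iff.2 fun h0 => h (by rw [h0, coeff_zero]), ?_⟩
  exact coeff_mem_coeffs h

theorem exists_map_eq (R : Subalgebra ℤ K) (a : W K) (ha : ∀ c ∈ allCoeffs (symb a), c ∈ R) :
    ∃ b : W R, map R.val.toRingHom b = a := by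
  have h1 : ∀ i, (symb a).coeff i ∈ Set.range (mapRingHom R.val.toRingHom) := by
    intro i
    have : (symb a).coeff i ∈ lifts R.val.toRingHom := by
      rw [lifts_iff_coeff_lifts]
      intro j
      by_cases h0 : ((symb a).coeff i).coeff j = 0
      · exact ⟨0, by rw [h0, map_zero]⟩
      · exact ⟨⟨_, ha _ (mem_allCoeffs _ h0)⟩, rfl⟩
    rw [mem_lifts] at this
    exact this
  have h2 : symb a ∈ lifts (mapRingHom R.val.toRingHom) := by
    rw [lifts_iff_coeff_lifts]; exact h1
  obtain ⟨m, hm⟩ := (mem_lifts _).1 h2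
  exact ⟨ofPoly _ m, by rw [map_ofPoly, hm, ofPoly_symb]⟩

/-- Nonzero primes are maximal; an integer z in the Jacobson radical of 0 makes z² + 1 a unit, so z
= 0. -/
theorem isJacobsonRing_int : IsJacobsonRing ℤ := by
  rw [isJacobsonRing_iff_prime_eq]
  intro P hP
  rcases eq_or_ne P ⊥ with rfl | hP0
  · rw [eq_bot_iff]
    intro z hz
    have h := Ideal.mem_jacobson_bot.1 hz z
    rw [Int.isUnit_iff] at h
    rw [Ideal.mem_bot]
    rcases h with h | h <;> nlinarith [mul_self_nonneg z]
  · have := hP.isMaximal hP0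
    exact Ideal.jacobson_eq_self_of_isMaximal

/-- In characteristic zero the Nullstellensatz over the Jacobson ring ℤ would make `k` integral over
ℤ, and ℤ a field. -/
theorem exists_prime_charP {R k : Type u} [CommRing R] [Field k] (hR : Algebra.FiniteType ℤ R)
    (g : R →+* k) (hg : Function.Surjective g) : ∃ p, p.Prime ∧ CharP k p := by
  obtain ⟨p, hp⟩ := CharP.exists k
  refine ⟨p, (CharP.char_is_prime_or_zero k p).resolve_right ?_, hp⟩
  rintro rfl
  have := CharP.charP_to_charZero k
  have := isJacobsonRing_int
  have : Algebra.FiniteType ℤ k := hR.of_surjective g.toIntAlgHom hg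
  have := finite_of_finite_type_of_isJacobsonRing ℤ k
  exact Int.not_isField (isField_of_isIntegral_of_isField (R := ℤ) (S := k)
    (FaithfulSMul.algebraMap_injective ℤ k) (Field.toIsField k))

variable [CharZero K]

theorem pair_degree_le {S T : W K} (h : T * S = S * T + 1)
    (hT : bar K T = MulOpposite.op (-T)) :
    (symb S).natDegree ≤ 1 ∧ (symb T).natDegree ≤ 0 := by
  classical
  by_contra hcon
  obtain ⟨c, hc0, hc⟩ : ∃ c : K, c ≠ 0 ∧ ((∃ i j, 1 < i ∧ ((symb S).coeff i).coeff j = c) ∨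
      ∃ i j, 0 < i ∧ ((symb T).coeff i).coeff j = c) := by
    have key : ∀ (F : K[X][X]) d, ¬ F.natDegree ≤ d →
        ∃ c : K, c ≠ 0 ∧ ∃ i j, d < i ∧ (F.coeff i).coeff j = c := by
      intro F d hF
      have hF0 : F.coeff F.natDegree ≠ 0 := by
        rw [coeff_natDegree, Ne, leadingCoeff_eq_zero]
        rintro rfl
        simp at hF
      exact ⟨_, leadingCoeff_ne_zero.2 hF0, _, _, not_le.1 hF, coeff_natDegree⟩
    by_cases h1 : (symb S).natDegree ≤ 1
    · obtain ⟨c, hc, h2⟩ := key _ 0 fun h2 => hcon ⟨h1, h2⟩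
      exact ⟨c, hc, Or.inr h2⟩
    · obtain ⟨c, hc, h2⟩ := key _ 1 h1
      exact ⟨c, hc, Or.inl h2⟩
  obtain ⟨D₁, hD₁⟩ := exists_innerDegLE (symb S)
  obtain ⟨D₂, hD₂⟩ := exists_innerDegLE (symb T)
  -- `D` bounds all degrees involved; the final `+ 1` ensures that `p > 2 * D + 1` excludes `p = 2`.
  let D := D₁ + D₂ + (symb S).natDegree + (symb T).natDegree + 1
  -- Adjoining c⁻¹ keeps the offending coefficient nonzero in every residue field; the inverse
  -- factorial forces residue characteristic above 2D + 1.
  let s : Finset K := allCoeffs (symb S) ∪ allCoeffs (symb T) ∪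
    {c⁻¹, (((2 * D + 1).factorial : ℕ) : K)⁻¹}
  let R : Subalgebra ℤ K := Algebra.adjoin ℤ (s : Set K)
  have hs : ∀ z ∈ s, z ∈ R := fun z hz => Algebra.subset_adjoin hz
  have hinj : Function.Injective R.val.toRingHom := Subtype.val_injective
  obtain ⟨S', hS'⟩ := exists_map_eq R S fun z hz => hs z (by simp [s, hz])
  obtain ⟨T', hT'⟩ := exists_map_eq R T fun z hz => hs z (by simp [s, hz])
  have hpair : T' * S' = S' * T' + 1 := map_injective hinj (by
    rw [map_mul, map_add, map_mul, map_one, hS', hT', h])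
  have hbar : bar R T' = MulOpposite.op (-T') := by
    refine MulOpposite.unop_injective (map_injective hinj (MulOpposite.op_injective ?_))
    rw [← bar_map, hT', hT, MulOpposite.unop_op, map_neg, hT']
  obtain ⟨m, hm⟩ := Ideal.exists_maximal R
  let _ : Field (R ⧸ m) := Ideal.Quotient.field m
  have hfin : Algebra.FiniteType ℤ R :=
    (Subalgebra.fg_iff_finiteType R).1 (Subalgebra.fg_adjoin_finset s)
  obtain ⟨p, hp, hchar⟩ := exists_prime_charP hfin (Ideal.Quotient.mk m)
    Ideal.Quotient.mk_surjective
  have hunit : ∀ (r : R) (z : K), z ∈ R → r * z = 1 → Ideal.Quotient.mk m r ≠ 0 := by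
    intro r z hz hrz h0
    have h1 : r * ⟨z, hz⟩ = 1 := Subtype.ext hrz
    have h2 := congrArg (Ideal.Quotient.mk m) h1
    rw [map_mul, h0, zero_mul, map_one] at h2
    exact zero_ne_one h2
  have hpD : 2 * D + 1 < p := by
    by_contra hle
    refine hunit ((2 * D + 1).factorial : ℕ) _ (hs (((2 * D + 1).factorial : ℕ) : K)⁻¹
      (by simp [s])) ?_ ?_
    · simp [Nat.factorial_ne_zero]
    · rw [map_natCast, CharP.cast_eq_zero_iff _ p]
      exact (Nat.Prime.dvd_factorial hp).2 (not_lt.1 hle)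
  have : Fact p.Prime := ⟨hp⟩
  have hsymb : ∀ (a : W R) (b : W K), map R.val.toRingHom a = b →
      ∀ i, (symb b).coeff i = ((symb a).coeff i).map R.val.toRingHom := by
    rintro a _ rfl i
    rw [symb_map, coeff_map, coe_mapRingHom]
  have hnat : ∀ (a : W R) (b : W K), map R.val.toRingHom a = b →
      (symb a).natDegree = (symb b).natDegree := by
    rintro a _ rfl
    rw [symb_map, natDegree_map_eq_of_injective (Polynomial.map_injective _ hinj)]
  have hinner : ∀ (a : W R) (b : W K) e, map R.val.toRingHom a = b → InnerDegLE (symb b) e →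
      e ≤ D → InnerDegLE (symb a) D := by
    rintro a b e hab hb he i
    rw [← natDegree_map_eq_of_injective hinj, ← hsymb a b hab]
    exact (hb i).trans he
  have hred := pair_reduction (p := p) (by omega) (fun r hr => by
      refine (mul_eq_zero.1 hr).resolve_left ?_
      exact_mod_cast hp.ne_zero) (Ideal.Quotient.mk m) hpair hbar (D := D) (by omega)
    (by rw [hnat _ _ hS']; omega) (hinner _ _ _ hS' hD₁ (by omega))
    (by rw [hnat _ _ hT']; omega) (hinner _ _ _ hT' hD₂ (by omega))
  have hfinal : ∀ (a : W R) (b : W K) d, map R.val.toRingHom a = b →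
      (symb (map (Ideal.Quotient.mk m) a)).natDegree ≤ d →
      ∀ i j, d < i → ((symb b).coeff i).coeff j = c → False := by
    intro a b d hab hd i j hi hij
    have h1 : ((symb (map (Ideal.Quotient.mk m) a)).coeff i).coeff j = 0 := by
      rw [coeff_eq_zero_of_natDegree_lt (hd.trans_lt hi), coeff_zero]
    rw [symb_map, coeff_map, coe_mapRingHom, coeff_map] at h1
    rw [hsymb a b hab, coeff_map] at hij
    refine hunit _ c⁻¹ (hs _ (by simp [s])) ?_ h1
    have : (((symb a).coeff i).coeff j : K) = c := hij
    rw [this, mul_inv_cancel₀ hc0]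
  rcases hc with ⟨i, j, hi, hij⟩ | ⟨i, j, hi, hij⟩
  · exact hfinal _ _ _ hS' hred.1 i j hi hij
  · exact hfinal _ _ _ hT' hred.2 i j hi hij

/-- A Weyl pair with skew second member is triangular. -/
theorem pair_triangular {S T : W K} (h : T * S = S * T + 1)
    (hT : bar K T = MulOpposite.op (-T)) :
    ∃ (c : K) (f : K[X]), c ≠ 0 ∧ T = algebraMap K _ c * y K ∧
      S = algebraMap K _ c⁻¹ * x K + aeval (y K) f := by
  obtain ⟨hS1, hT1⟩ := pair_degree_le h hT
  obtain ⟨τ, hτ⟩ := natDegree_eq_zero.1 (Nat.le_zero.1 hT1)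
  obtain ⟨s, w, hsw⟩ := exists_eq_X_add_C_of_natDegree_le_one hS1
  have eT : T = aeval (y K) τ := by
    rw [← ofPoly_symb T, ← hτ, ← monomial_zero_left, ofPoly_monomial, pow_zero, one_mul]
  have eS : S = x K * aeval (y K) s + aeval (y K) w := by
    rw [← ofPoly_symb S, hsw, map_add, ← pow_one (X : K[X][X]), C_mul_X_pow_eq_monomial,
      ← monomial_zero_left, ofPoly_monomial, ofPoly_monomial, pow_zero, one_mul, pow_one]
  have hcomm : ∀ f g : K[X], Commute (aeval (y K) f) (aeval (y K) g) := fun f g => by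
    rw [Commute, SemiconjBy, ← map_mul, ← map_mul, mul_comm]
  -- With T = τ(y) and S = x s(y) + w(y), the relation TS - ST = 1 reads τ' s = 1.
  have h1 : aeval (y K) (derivative τ * s) = aeval (y K) (1 : K[X]) := by
    have h2 := commutator_x 0 τ
    simp only [ofPoly_monomial, pow_zero, one_mul] at h2
    have h3 : T * S - S * T = 1 := by rw [h]; abel
    rw [map_mul, ← h2, map_one, ← h3, eT, eS, mul_add, add_mul, (hcomm τ w).eq, mul_assoc (x K),
      (hcomm s τ).eq]
    noncomm_ring
  have h2 : derivative τ * s = 1 := by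
    have := congrArg symb h1
    rw [symb_aeval_y, symb_aeval_y] at this
    exact C_injective this
  have hne := left_ne_zero_of_mul_eq_one h2
  have hdeg := congrArg natDegree h2
  rw [natDegree_mul hne (right_ne_zero_of_mul_eq_one h2), natDegree_one, natDegree_derivative]
    at hdeg
  obtain ⟨c, b, rfl⟩ := exists_eq_X_add_C_of_natDegree_le_one (p := τ) (by omega)
  obtain ⟨s₀, rfl⟩ := natDegree_eq_zero.1 (show s.natDegree = 0 by omega)
  have hcs : c * s₀ = 1 := by
    have : C (c * s₀) = (1 : K[X]) := by
      rw [← h2]; simp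
    simpa using congrArg (coeff · 0) this
  have hc : c ≠ 0 := left_ne_zero_of_mul_eq_one hcs
  have eT' : T = algebraMap K _ c * y K + algebraMap K _ b := by rw [eT]; simp
  -- Skewness of cy + b says b = -b.
  have hb : b = 0 := by
    have h4 := congrArg MulOpposite.unop hT
    rw [eT', map_add, map_mul, bar_y, AlgHom.commutes, AlgHom.commutes,
      MulOpposite.algebraMap_apply, MulOpposite.algebraMap_apply, ← MulOpposite.op_mul,
      ← MulOpposite.op_add, MulOpposite.unop_op, MulOpposite.unop_op, neg_mul,
      ← Algebra.commutes c (y K)] at h4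
    have h5 : algebraMap K (W K) (b + b) = 0 := by
      rw [map_add]
      calc _ = (-(algebraMap K (W K) c * y K) + algebraMap K (W K) b) +
          (algebraMap K (W K) c * y K + algebraMap K (W K) b) := by abel
        _ = 0 := by rw [h4]; abel
    have h6 := congrArg (fun z => ((symb z).coeff 0).coeff 0) h5
    simp only [Algebra.algebraMap_eq_smul_one, map_smul, symb_one, map_zero] at h6
    simpa using h6
  refine ⟨c, w, hc, by rw [eT', hb, map_zero, add_zero], ?_⟩
  rw [eS, aeval_C, eq_inv_of_mul_eq_one_right hcs, Algebra.commutes]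

end charZero

end

end Weyl

namespace DixmierA1

noncomputable section

open MulOpposite

variable {K : Type u} [Field K]

/-! ### Inverses and composites of endomorphisms and anti-endomorphisms -/

theorem algHom_ext {A : Type u} [Ring A] [Algebra K A] {f g : A₁ K →ₐ[K] A}
    (hX : f (X K) = g (X K)) (hY : f (Y K) = g (Y K)) : f = g := by
  refine RingQuot.ringQuot_ext' (S := K) (s := WeylRel K) f g (FreeAlgebra.hom_ext ?_)
  funext i
  fin_cases i
  · exact hX
  · exact hY

theorem isEndo_iff {φ : A₁ K →ₗ[K] A₁ K} :
    IsEndo φ ↔ φ 1 = 1 ∧ ∀ a b, φ (a * b) = φ a * φ b := by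
  constructor
  · rintro ⟨f, hf⟩
    exact ⟨by rw [← hf, map_one], fun a b => by rw [← hf, ← hf, ← hf, map_mul]⟩
  · rintro ⟨h1, h2⟩
    exact ⟨AlgHom.ofLinearMap φ h1 h2, fun _ => rfl⟩

theorem isAntiEndo_iff {φ : A₁ K →ₗ[K] A₁ K} :
    IsAntiEndo φ ↔ φ 1 = 1 ∧ ∀ a b, φ (a * b) = φ b * φ a := by
  constructor
  · rintro ⟨f, hf⟩
    refine ⟨op_injective ?_, fun a b => op_injective ?_⟩
    · rw [← hf, map_one, op_one]
    · rw [← hf, map_mul, hf, hf, op_mul]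
  · rintro ⟨h1, h2⟩
    exact ⟨AlgHom.ofLinearMap ((opLinearEquiv K).toLinearMap ∘ₗ φ) (by simp [h1])
      (fun a b => by simp [h2]), fun _ => rfl⟩

theorem α_apply_α (a : A₁ K) : α K (α K a) = a :=
  DFunLike.congr_fun isInvolution_α.2 a

theorem IsAuto.symm {g : A₁ K ≃ₗ[K] A₁ K} (hg : IsAuto g) : IsAuto g.symm := by
  obtain ⟨h1, h2⟩ := isEndo_iff.1 hg
  refine isEndo_iff.2 ⟨g.injective ?_, fun a b => g.injective ?_⟩
  · simpa using h1.symm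
  · have := h2 (g.symm a) (g.symm b)
    simpa using this.symm

theorem IsAntiAuto.symm {g : A₁ K ≃ₗ[K] A₁ K} (hg : IsAntiAuto g) : IsAntiAuto g.symm := by
  obtain ⟨h1, h2⟩ := isAntiEndo_iff.1 hg
  refine isAntiEndo_iff.2 ⟨g.injective ?_, fun a b => g.injective ?_⟩
  · simpa using h1.symm
  · have := h2 (g.symm b) (g.symm a)
    simpa using this.symm

theorem isEndo_algHom (f : A₁ K →ₐ[K] A₁ K) : IsEndo f.toLinearMap := ⟨f, fun _ => rfl⟩

section comp
variable {φ ψ : A₁ K →ₗ[K] A₁ K}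

theorem IsEndo.comp (hφ : IsEndo φ) (hψ : IsEndo ψ) : IsEndo (φ ∘ₗ ψ) := by
  rw [isEndo_iff] at *
  simp [hφ, hψ]

theorem IsEndo.comp_anti (hφ : IsEndo φ) (hψ : IsAntiEndo ψ) : IsAntiEndo (φ ∘ₗ ψ) := by
  rw [isEndo_iff] at hφ
  rw [isAntiEndo_iff] at *
  simp [hφ, hψ]

theorem IsAntiEndo.comp_endo (hφ : IsAntiEndo φ) (hψ : IsEndo ψ) : IsAntiEndo (φ ∘ₗ ψ) := by
  rw [isEndo_iff] at hψ
  rw [isAntiEndo_iff] at *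
  simp [hφ, hψ]

theorem IsAntiEndo.comp (hφ : IsAntiEndo φ) (hψ : IsAntiEndo ψ) : IsEndo (φ ∘ₗ ψ) := by
  rw [isAntiEndo_iff] at *
  rw [isEndo_iff]
  simp [hφ, hψ]

end comp

/-! ### Comparison with the model over commutative rings -/

section charZero
variable [CharZero K]

variable (K) in
theorem half_add_half {V : Type u} [AddCommGroup V] [Module K V] (v : V) :
    (2⁻¹ : K) • v + (2⁻¹ : K) • v = v := by
  rw [← add_smul, show ((2⁻¹ : K) + 2⁻¹) = 1 by norm_num, one_smul]

variable (K) in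
/-- The coordinates `x = X + Y`, `y = (Y - X) / 2`, in which `α` fixes `x` and negates `y`. -/
def toW : A₁ K →ₐ[K] Weyl.W K :=
  lift K ((2⁻¹ : K) • Weyl.x K - Weyl.y K) ((2⁻¹ : K) • Weyl.x K + Weyl.y K) (by
    have h := half_add_half K (1 : Weyl.W K)
    simp only [mul_sub, add_mul, mul_add, sub_mul, smul_mul_assoc, mul_smul_comm, Weyl.y_mul_x,
      smul_add, smul_sub]
    rw [← sub_eq_zero] at h ⊢
    rw [← h]
    abel)

variable (K) in
/-- The inverse of the change of coordinates. -/
def ofW : Weyl.W K →ₐ[K] A₁ K :=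
  Weyl.lift (X K + Y K) ((2⁻¹ : K) • (Y K - X K)) (by
    have h := half_add_half K (1 : A₁ K)
    simp only [mul_sub, add_mul, mul_add, sub_mul, smul_mul_assoc, mul_smul_comm, Y_mul_X,
      smul_add, smul_sub]
    rw [← sub_eq_zero] at h ⊢
    rw [← h]
    abel)

theorem toW_X : toW K (X K) = (2⁻¹ : K) • Weyl.x K - Weyl.y K := lift_X K _ _ _

theorem toW_Y : toW K (Y K) = (2⁻¹ : K) • Weyl.x K + Weyl.y K := lift_Y K _ _ _

theorem ofW_x : ofW K (Weyl.x K) = X K + Y K := Weyl.lift_x _ _ _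

theorem ofW_y : ofW K (Weyl.y K) = (2⁻¹ : K) • (Y K - X K) := Weyl.lift_y _ _ _

theorem ofW_toW (a : A₁ K) : ofW K (toW K a) = a := by
  refine DFunLike.congr_fun (?_ : (ofW K).comp (toW K) = AlgHom.id K _) a
  refine algHom_ext ?_ ?_
  · rw [AlgHom.comp_apply, toW_X, map_sub, map_smul, ofW_x, ofW_y, AlgHom.id_apply, smul_add,
      smul_sub]
    conv_rhs => rw [← half_add_half K (X K)]
    abel
  · rw [AlgHom.comp_apply, toW_Y, map_add, map_smul, ofW_x, ofW_y, AlgHom.id_apply, smul_add,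
      smul_sub]
    conv_rhs => rw [← half_add_half K (Y K)]
    abel

theorem toW_ofW (a : Weyl.W K) : toW K (ofW K a) = a := by
  refine DFunLike.congr_fun (?_ : (toW K).comp (ofW K) = AlgHom.id K _) a
  refine Weyl.algHom_ext ?_ ?_
  · rw [AlgHom.comp_apply, ofW_x, map_add, toW_X, toW_Y, AlgHom.id_apply]
    conv_rhs => rw [← half_add_half K (Weyl.x K)]
    abel
  · rw [AlgHom.comp_apply, ofW_y, map_smul, map_sub, toW_X, toW_Y, AlgHom.id_apply]
    conv_rhs => rw [← half_add_half K (Weyl.y K)]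
    rw [← smul_add]
    congr 1
    abel

theorem bar_toW (a : A₁ K) : Weyl.bar K (toW K a) = op (toW K (α K a)) := by
  have h : (Weyl.bar K).comp (toW K) = (AlgHom.op (toW K)).comp (exchangeOp K) := by
    refine algHom_ext ?_ ?_
    · have : exchangeOp K (X K) = op (Y K) := lift_X K _ _ _
      simp [this, toW_X, toW_Y, Weyl.bar_x, Weyl.bar_y]
    · have : exchangeOp K (Y K) = op (X K) := lift_Y K _ _ _
      simp [this, toW_X, toW_Y, Weyl.bar_x, Weyl.bar_y, sub_eq_add_neg]
  exact DFunLike.congr_fun h a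

omit [CharZero K] in
/-- An endomorphism of the Weyl algebra of triangular form is bijective. -/
theorem bijective_of_triangular (F : Weyl.W K →ₐ[K] Weyl.W K) (c : K) (f : Polynomial K)
    (hc : c ≠ 0) (hy : F (Weyl.y K) = algebraMap K _ c * Weyl.y K)
    (hx : F (Weyl.x K) = algebraMap K _ c⁻¹ * Weyl.x K + Polynomial.aeval (Weyl.y K) f) :
    Function.Bijective F := by
  let y' : Weyl.W K := c⁻¹ • Weyl.y K
  have hcomm : Commute (Weyl.y K) (Polynomial.aeval y' f) := by
    have h1 : Weyl.y K = Polynomial.aeval y' (c • (Polynomial.X : Polynomial K)) := by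
      simp [y', smul_smul, hc]
    rw [Commute, SemiconjBy]
    conv_lhs => rw [h1]
    conv_rhs => rw [h1]
    rw [← map_mul, ← map_mul, mul_comm]
  have hrel : ∀ P, Commute (Weyl.y K) P → y' * (c • (Weyl.x K - P)) =
      c • (Weyl.x K - P) * y' + 1 := fun P hP => by
    simp only [y', smul_mul_assoc, mul_smul_comm, smul_smul, inv_mul_cancel₀ hc,
      mul_inv_cancel₀ hc, one_smul, mul_sub, sub_mul, smul_sub, Weyl.y_mul_x, hP.eq]
    abel
  -- The inverse solves the triangular system: y ↦ c⁻¹y and x ↦ c(x - f(c⁻¹y)).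
  let G : Weyl.W K →ₐ[K] Weyl.W K :=
    Weyl.lift (c • (Weyl.x K - Polynomial.aeval y' f)) y' (hrel _ hcomm)
  have hGx : G (Weyl.x K) = c • (Weyl.x K - Polynomial.aeval y' f) := Weyl.lift_x _ _ _
  have hGy : G (Weyl.y K) = y' := Weyl.lift_y _ _ _
  rw [← Algebra.smul_def] at hy hx
  have hFy' : F y' = Weyl.y K := by
    simp [y', hy, smul_smul, hc]
  have hFG : F.comp G = AlgHom.id K _ := by
    refine Weyl.algHom_ext ?_ ?_
    · rw [AlgHom.comp_apply, hGx, map_smul, map_sub, hx, ← Polynomial.aeval_algHom_apply, hFy',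
        add_sub_cancel_right, smul_smul, mul_inv_cancel₀ hc, one_smul, AlgHom.id_apply]
    · rw [AlgHom.comp_apply, hGy, hFy', AlgHom.id_apply]
  have hGF : G.comp F = AlgHom.id K _ := by
    refine Weyl.algHom_ext ?_ ?_
    · rw [AlgHom.comp_apply, hx, map_add, map_smul, hGx, ← Polynomial.aeval_algHom_apply, hGy,
        smul_smul, inv_mul_cancel₀ hc, one_smul, sub_add_cancel, AlgHom.id_apply]
    · rw [AlgHom.comp_apply, hy, map_smul, hGy, smul_smul, mul_inv_cancel₀ hc, one_smul,
        AlgHom.id_apply]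
  exact Function.bijective_iff_has_inverse.2
    ⟨G, fun a => DFunLike.congr_fun hGF a, fun a => DFunLike.congr_fun hFG a⟩

/-- Every `α`-endomorphism is bijective. -/
theorem IsAlphaEndo.bijective {φ : A₁ K →ₗ[K] A₁ K} (hφ : IsAlphaEndo φ) :
    Function.Bijective φ := by
  obtain ⟨⟨f, hf⟩, hα⟩ := hφ
  let F : Weyl.W K →ₐ[K] Weyl.W K := (toW K).comp (f.comp (ofW K))
  have hpair : F (Weyl.y K) * F (Weyl.x K) = F (Weyl.x K) * F (Weyl.y K) + 1 := by
    rw [← map_mul, Weyl.y_mul_x, map_add, map_mul, map_one]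
  -- φ commutes with α and α negates the element corresponding to y, so its image is again skew.
  have hskew : Weyl.bar K (F (Weyl.y K)) = op (-F (Weyl.y K)) := by
    have h1 : α K (ofW K (Weyl.y K)) = -ofW K (Weyl.y K) := by
      rw [ofW_y, map_smul, map_sub, α_X, α_Y, ← neg_sub, smul_neg]
    have h2 : α K (f (ofW K (Weyl.y K))) = -f (ofW K (Weyl.y K)) := by
      have := DFunLike.congr_fun hα (ofW K (Weyl.y K))
      simp only [LinearMap.comp_apply, h1, map_neg, ← hf] at this
      exact this.symm
    rw [AlgHom.comp_apply, AlgHom.comp_apply, bar_toW, h2, map_neg]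
  obtain ⟨c, p, hc, hy, hx⟩ := Weyl.pair_triangular hpair hskew
  have hF := bijective_of_triangular F c p hc hy hx
  have hφF : (φ : A₁ K → A₁ K) = ofW K ∘ F ∘ toW K := by
    funext a
    simp only [F, Function.comp_apply, AlgHom.comp_apply, ofW_toW, hf]
  have b1 : Function.Bijective (ofW K) :=
    Function.bijective_iff_has_inverse.2 ⟨toW K, toW_ofW, ofW_toW⟩
  have b2 : Function.Bijective (toW K) :=
    Function.bijective_iff_has_inverse.2 ⟨ofW K, ofW_toW, toW_ofW⟩
  rw [hφF]
  exact b1.comp (hF.comp b2)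

/-- Every `α`-anti-endomorphism is bijective. -/
theorem IsAlphaAntiEndo.bijective {φ : A₁ K →ₗ[K] A₁ K} (hφ : IsAlphaAntiEndo φ) :
    Function.Bijective φ := by
  have h1 : IsAlphaEndo (φ ∘ₗ α K) :=
    ⟨hφ.1.comp isAntiEndo_α, by rw [hφ.2, LinearMap.comp_assoc, hφ.2]⟩
  have hb : Function.Bijective (α K) :=
    Function.bijective_iff_has_inverse.2 ⟨α K, α_apply_α, α_apply_α⟩
  have h2 : Function.Bijective (φ ∘ α K) := h1.bijective
  exact (Function.Bijective.of_comp_iff φ hb).1 h2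

/-! ### The implications between the three conjectures -/

theorem dixmier_of_gh (h : GHConjecture K) : DixmierConjecture K := by
  intro f
  obtain ⟨g, h, hgh⟩ := h f
  have hb : Function.Bijective (twist g h f) := by
    rcases hgh with ⟨-, hgh⟩ | ⟨-, hgh⟩
    · exact hgh.bijective
    · exact hgh.bijective
  have hf : (f : A₁ K → A₁ K) = h.symm ∘ twist g h f ∘ g := by
    funext a
    simp [twist]
  rw [hf]
  exact h.symm.bijective.comp (hb.comp g.bijective)

end charZero

/-- The conjugating maps of γ and δ serve as `g` and `h`; their kinds decide whether the twist is an
endomorphism or an anti-endomorphism. -/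
theorem gh_of_gammaDelta (h : GammaDeltaConjecture K) : GHConjecture K := by
  intro f
  obtain ⟨γ, δ, -, -, ⟨g, hg, hγ⟩, ⟨h, hh, hδ⟩, hf⟩ := h f
  have hα : twist g h f ∘ₗ α K = α K ∘ₗ twist g h f := by
    ext a
    have h1 := DFunLike.congr_fun hf (g.symm a)
    simp only [hγ, hδ, LinearMap.comp_apply, LinearEquiv.coe_coe, LinearEquiv.apply_symm_apply,
      AlgHom.toLinearMap_apply] at h1
    simp only [twist, LinearMap.comp_apply, LinearEquiv.coe_coe, AlgHom.toLinearMap_apply, h1,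
      LinearEquiv.apply_symm_apply]
  have hfe := isEndo_algHom f
  refine ⟨g, h, ?_⟩
  rcases hg with hg | hg <;> rcases hh with hh | hh
  · exact Or.inl ⟨Or.inl ⟨hg, hh⟩, IsEndo.comp hh (hfe.comp hg.symm), hα⟩
  · exact Or.inr ⟨Or.inl ⟨hg, hh⟩, IsAntiEndo.comp_endo hh (hfe.comp hg.symm), hα⟩
  · exact Or.inr ⟨Or.inr ⟨hg, hh⟩, IsEndo.comp_anti hh (hfe.comp_anti hg.symm), hα⟩
  · exact Or.inl ⟨Or.inr ⟨hg, hh⟩, IsAntiEndo.comp hh (hfe.comp_anti hg.symm), hα⟩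

theorem isAuto_refl : IsAuto (LinearEquiv.refl K (A₁ K)) := isEndo_algHom (AlgHom.id K _)

/-- An automorphism f transports α to the involution fαf⁻¹, conjugate to α through f⁻¹. -/
theorem gammaDelta_of_dixmier (h : DixmierConjecture K) : GammaDeltaConjecture K := by
  intro f
  let e : A₁ K ≃ₗ[K] A₁ K := LinearEquiv.ofBijective f.toLinearMap (h f)
  have he : IsAuto e := isEndo_algHom f
  have hea : ∀ a, e a = f a := fun _ => rfl
  refine ⟨α K, e.toLinearMap ∘ₗ α K ∘ₗ e.symm.toLinearMap, isInvolution_α,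
    ⟨IsEndo.comp_anti he (isAntiEndo_α.comp_endo he.symm), ?_⟩,
    ⟨LinearEquiv.refl K _, Or.inl isAuto_refl, rfl⟩,
    ⟨e.symm, Or.inl he.symm, rfl⟩, ?_⟩
  · ext a
    simp [α_apply_α]
  · refine LinearMap.ext fun a => ?_
    simp only [LinearMap.comp_apply, AlgHom.toLinearMap_apply, LinearEquiv.coe_coe]
    rw [← hea a, e.symm_apply_apply, hea]

theorem gh_of_dixmier (h : DixmierConjecture K) : GHConjecture K :=
  gh_of_gammaDelta (gammaDelta_of_dixmier h)

end

end DixmierA1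

theorem mainTheorem3 (K : Type u) [Field K] [CharZero K] :
    (DixmierA1.DixmierConjecture K ↔ DixmierA1.GammaDeltaConjecture K) ∧
    (DixmierA1.DixmierConjecture K ↔ DixmierA1.GHConjecture K) :=
  ⟨⟨DixmierA1.gammaDelta_of_dixmier, fun h =>
      DixmierA1.dixmier_of_gh (DixmierA1.gh_of_gammaDelta h)⟩,
    ⟨DixmierA1.gh_of_dixmier, DixmierA1.dixmier_of_gh⟩⟩
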